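/- Let $P=(a_1,\dots,a_\alpha\,|\,b_1,\dots,b_\beta\,|\,c_1,\dots,c_\gamma)$ be a strictly decreasing sequence of integers divided into three non-empty blocks; its type is $(\alpha,\beta,\gamma)$ and its dimension is $N=\alpha\beta+\alpha\gamma+\beta\gamma$. For an integer $t\ge 0$ let $P(t)$ be obtained from $P$ by subtracting $2t$ from the entries of the first block, $t$ from those of the second block, and $0$ from those of the third. $P$ is called an Ulrich partition if $P(t)$ has a repeated entry for every $t\in\{1,\dots,N\}$. Two partitions are equivalent if they differ by a constant added to all entries. The symmetric partition is $P^s=(-c_\gamma,\dots,-c_1\,|\,-b_\beta,\dots,-b_1\,|\,-a_\alpha,\dots,-a_1)$; the dual $P^*$ of an Ulrich partition $P$ consists of the blocks of $P(N+1)$ written in reversed order; the symmetric dual $(P^s)^*$ has the same type as $P$. For integers $m_1,m_2\ge 0$ put $k_i=\sum_{j=0}^{m_i}4^j=\frac{4^{m_i+1}-1}{3}$. **Theorem 5.3.** There are Ulrich partitions of the following types: 1. $(2,2,2)$, 2. $(2,2,3)$, 3. $(1,2,k_1)$ for every $m_1\ge 0$, 4. $(1,2,k_1+k_2)$ for all $m_1,m_2\ge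 0$. Up to symmetry these are all the types: if there is an Ulrich partition of type $(\alpha,2,\gamma)$, then $(\alpha,2,\gamma)$ or $(\gamma,2,\alpha)$ is in the list. For every type in the list other than $(1,2,1)$, $(1,2,2)$ and $(2,2,2)$, the Ulrich partition of that type is unique, modulo equivalence, up to taking the symmetric dual; for these three types it is not unique in this sense. -/

import Mathlib

namespace UlrichPartition

/-- A collection of `r + 1` blocks of integers, indexed from `0` to `r`. A strictly decreasing block
`a₁ > ⋯ > a_l` is recorded as its set of entries. -/
abbrev Blocks (r : ℕ) : Type := Fin (r + 1) → Finset ℤ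

variable {r : ℕ}

/-- The blocks, each written in decreasing order and put one after the other, form a strictly
decreasing sequence, and no block is empty. -/
def IsPartition (P : Blocks r) : Prop :=
  (∀ i, (P i).Nonempty) ∧ ∀ i j, i < j → ∀ x ∈ P i, ∀ y ∈ P j, y < x

/-- `P` has type `(l₀, …, l_r)`: the `i`-th block has `l i` entries. -/
def HasType (P : Blocks r) (l : Fin (r + 1) → ℕ) : Prop :=
  ∀ i, (P i).card = l i

/-- The dimension `∑_{i < j} l_i l_j`. -/
def dim (P : Blocks r) : ℕ :=
  ∑ i, ∑ j ∈ Finset.Ioi i, (P i).card * (P j).card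

/-- The position at time `t` of an entry `x` of block `i`. Each entry of the first block moves by
`-r` per unit of time, of the second block by `-(r - 1)`, and so on; the last block is fixed. -/
def position (i : Fin (r + 1)) (x : ℤ) (t : ℕ) : ℤ :=
  x - (t : ℤ) * ((r : ℤ) - (i.val : ℤ))

/-- `P(t)` has a repeated entry: two different entries of `P` are at the same position at time
`t`. -/
def HasRepeatAt (P : Blocks r) (t : ℕ) : Prop :=
  ∃ i j, ∃ x ∈ P i, ∃ y ∈ P j, (i, x) ≠ (j, y) ∧ position i x t = position j y t

/-- `P` is an Ulrich partition: `P(t)` has a repeated entry for `t = 1, …, dim P`. -/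
def IsUlrich (P : Blocks r) : Prop :=
  IsPartition P ∧ ∀ t : ℕ, 1 ≤ t → t ≤ dim P → HasRepeatAt P t

/-- Two partitions are equivalent if they differ by a constant added to all the entries. -/
def Equivalent (P Q : Blocks r) : Prop :=
  ∃ c : ℤ, ∀ i, Q i = (P i).image (fun x => x + c)

/-- The symmetric partition `P^s`: negate all entries and reverse the order of the blocks. -/
def symmetric (P : Blocks r) : Blocks r :=
  fun i => (P i.rev).image (fun x => -x)

/-- The dual `P^*`: the blocks of `P(N + 1)` in reversed order, where `N = dim P`. -/
def dual (P : Blocks r) : Blocks r :=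
  fun i => (P i.rev).image (fun x => position i.rev x (dim P + 1))

/-- The symmetric dual `(P^s)^*`, which has the same type as `P`. -/
def symmetricDual (P : Blocks r) : Blocks r :=
  dual (symmetric P)

/-- The number `1 + 4 + ⋯ + 4 ^ m = (4 ^ (m + 1) - 1) / 3`. -/
def k (m : ℕ) : ℕ :=
  ∑ j ∈ Finset.range (m + 1), 4 ^ j

/-- `(α, 2, γ)` is one of the types `(2, 2, 2)`, `(2, 2, 3)`, `(1, 2, k m₁)`,
`(1, 2, k m₁ + k m₂)`. -/
def IsListed (α γ : ℕ) : Prop :=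
  (α = 2 ∧ γ = 2) ∨ (α = 2 ∧ γ = 3) ∨ (α = 1 ∧ ∃ m₁, γ = k m₁) ∨
    (α = 1 ∧ ∃ m₁ m₂, γ = k m₁ + k m₂)

end UlrichPartition

/-!
Write the middle block as `{b, b + d}` and put `X = A - (b + d)`, `Y = b - C` for the outer blocks
`A` and `C`. There are as many pairs of entries in different blocks as there are times `1, …, N`, and
a pair meets at most once. Hence `P` is an Ulrich partition exactly when the sets
`X`, `X + d`, `Y`, `Y + d` and `(X + Y + d) / 2` tile `[1, N]`, every position being reached by one
pair only (`tiling_of_isUlrich`). This structure, `Tiling`, is kept by exchanging `X` and `Y`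
(the symmetric partition), by translations, and by the reflection `n ↦ L + R - d - n` of the interval
(the symmetric dual). The classification is that of the tilings (`Tiling.isStandard`).

One may assume `1 ∈ X`. Parity at `2` shows that `d` and all of `X` are odd and `Y` is even, and the
positions up to `4` leave only `d = 1, 3, 5`. For `d = 5` the two ends of the interval determine
everything. For `d = 1` and `d = 3` the mechanism is the following. Let `z` be the smallest element
of one of the two sets, and use coordinates in which `z + d` is the origin. As long as sums with
further elements of that set do not interfere, a position `w` is covered either by an element `u = w`
or `u = w - d` of the other set, or by the half `w = u / 2`; so `w` is covered directly if and only if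
`2 * w` is not an element. Iterating, for `d = 1` membership depends on the parity of the binary
logarithm of `w` (`pattern_pos`, `pattern_neg`), and for `d = 3` on the residue of `w` modulo `3` and
on the logarithm of `w / 3` (`pattern_of_gap_three`).

If the set of `z` is a singleton and `d = 1`, the pattern fills the whole interval, which forces
`z = 4 ^ n` and `N = 4 ^ n + 4 ^ m` (`Tiling.eq_pattern_of_singleton`). A second element disturbs the
pattern at a definite place; comparing with the position halfway between the two elements, which no
sum with either of them can reach, leaves few possibilities for it
(`Tiling.second_of_gap_three`, `Tiling.four_mem_and_ten_mem`, `Tiling.second_of_ten_mem`). In these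
the reflected tiling has the same shape, and two sums coming from opposite ends of the interval
coincide (`Tiling.false_of_startsThree`, `Tiling.false_of_ten_mem`). Small sporadic tilings with
`d = 3` are those where the two ends overlap.

Conversely the patterns do tile (`isUlrich_pattern`), and the pair `(n, m)` is determined up to order
by `4 ^ n + 4 ^ m = 3 γ + 2`; the symmetric dual exchanges `n` and `m`.
-/

/-! ### Tilings of an interval -/

namespace UlrichPartition

/-- The sets `X`, `X + d`, `Y`, `Y + d` and `(X + Y + d) / 2` tile the integer interval `[L, R]`: they
consist of integers of `[L, R]`, cover it, and no position is reached twice. That `X + d` and `Y + d`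
are disjoint, and that the sums lie in `[L, R]`, follows from the fields, and so does `y = y'` in
`mid_mid`. Sets of integers rather than finsets are used so that translates and reflections are
preimages. -/
structure Tiling (X Y : Set ℤ) (d L R : ℤ) : Prop where
  nonempty_left : X.Nonempty
  nonempty_right : Y.Nonempty
  d_pos : 1 ≤ d
  mem_left : ∀ {x}, x ∈ X → L ≤ x ∧ x + d ≤ R
  mem_right : ∀ {y}, y ∈ Y → L ≤ y ∧ y + d ≤ R
  parity : ∀ {x y}, x ∈ X → y ∈ Y → (x + y + d) % 2 = 0
  cover : ∀ n, L ≤ n → n ≤ R → n ∈ X ∨ n - d ∈ X ∨ n ∈ Y ∨ n - d ∈ Y ∨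
    ∃ x ∈ X, ∃ y ∈ Y, x + y + d = 2 * n
  left_left : ∀ {x x'}, x ∈ X → x' ∈ X → x ≠ x' + d
  right_right : ∀ {y y'}, y ∈ Y → y' ∈ Y → y ≠ y' + d
  left_right : ∀ {x y}, x ∈ X → y ∈ Y → x ≠ y ∧ x ≠ y + d ∧ y ≠ x + d
  mid_left : ∀ {x y x'}, x ∈ X → y ∈ Y → x' ∈ X → x + y + d ≠ 2 * x' ∧ x + y + d ≠ 2 * x' + 2 * d
  mid_right : ∀ {x y y'}, x ∈ X → y ∈ Y → y' ∈ Y → x + y + d ≠ 2 * y' ∧ x + y + d ≠ 2 * y' + 2 * d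
  mid_mid : ∀ {x y x' y'}, x ∈ X → y ∈ Y → x' ∈ X → y' ∈ Y → x + y = x' + y' → x = x'

namespace Tiling

variable {X Y : Set ℤ} {d L R N : ℤ}

theorem swap (T : Tiling X Y d L R) : Tiling Y X d L R where
  nonempty_left := T.nonempty_right
  nonempty_right := T.nonempty_left
  d_pos := T.d_pos
  mem_left := T.mem_right
  mem_right := T.mem_left
  parity := fun hx hy => by have := T.parity hy hx; omega
  cover := fun n h1 h2 => by
    rcases T.cover n h1 h2 with h | h | h | h | ⟨x, hx, y, hy, e⟩
    · tauto
    · tauto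
    · tauto
    · tauto
    · exact Or.inr (Or.inr (Or.inr (Or.inr ⟨y, hy, x, hx, by omega⟩)))
  left_left := T.right_right
  right_right := T.left_left
  left_right := fun hx hy => by have := T.left_right hy hx; omega
  mid_left := fun hx hy hx' => by have := T.mid_right hy hx hx'; omega
  mid_right := fun hx hy hx' => by have := T.mid_left hy hx hx'; omega
  mid_mid := fun hx hy hx' hy' e => by
    have := T.mid_mid hy hx hy' hx' (by omega); omega

theorem translate (T : Tiling X Y d L R) (s : ℤ) :
    Tiling {u | u + s ∈ X} {u | u + s ∈ Y} d (L - s) (R - s) where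
  nonempty_left := by obtain ⟨x, hx⟩ := T.nonempty_left; exact ⟨x - s, by simpa using hx⟩
  nonempty_right := by obtain ⟨x, hx⟩ := T.nonempty_right; exact ⟨x - s, by simpa using hx⟩
  d_pos := T.d_pos
  mem_left := fun hx => by have := T.mem_left hx; omega
  mem_right := fun hx => by have := T.mem_right hx; omega
  parity := fun hx hy => by have := T.parity hx hy; omega
  cover := fun n h1 h2 => by
    have e1 : n - d + s = n + s - d := by ring
    simp only [Set.mem_ofPred_eq, e1]
    rcases T.cover (n + s) (by omega) (by omega) with h | h | h | h | ⟨x, hx, y, hy, e⟩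
    · tauto
    · tauto
    · tauto
    · tauto
    · exact Or.inr (Or.inr (Or.inr (Or.inr
        ⟨x - s, by simpa using hx, y - s, by simpa using hy, by omega⟩)))
  left_left := fun hx hy => by have := T.left_left hx hy; omega
  right_right := fun hx hy => by have := T.right_right hx hy; omega
  left_right := fun hx hy => by have := T.left_right hx hy; omega
  mid_left := fun hx hy hx' => by have := T.mid_left hx hy hx'; omega
  mid_right := fun hx hy hx' => by have := T.mid_right hx hy hx'; omega
  mid_mid := fun hx hy hx' hy' e => by
    have := T.mid_mid hx hy hx' hy' (by omega); omega

theorem reflect (T : Tiling X Y d L R) :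
    Tiling {u | L + R - d - u ∈ X} {u | L + R - d - u ∈ Y} d L R where
  nonempty_left := by
    obtain ⟨x, hx⟩ := T.nonempty_left; exact ⟨L + R - d - x, by simpa using hx⟩
  nonempty_right := by
    obtain ⟨x, hx⟩ := T.nonempty_right; exact ⟨L + R - d - x, by simpa using hx⟩
  d_pos := T.d_pos
  mem_left := fun hx => by have := T.mem_left hx; omega
  mem_right := fun hx => by have := T.mem_right hx; omega
  parity := fun hx hy => by have := T.parity hx hy; omega
  cover := fun n h1 h2 => by
    have e1 : L + R - d - (n - d) = L + R - n := by ring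
    have e2 : L + R - d - n = L + R - n - d := by ring
    simp only [Set.mem_ofPred_eq, e1, e2]
    rcases T.cover (L + R - n) (by omega) (by omega) with h | h | h | h | ⟨x, hx, y, hy, e⟩
    · tauto
    · tauto
    · tauto
    · tauto
    · exact Or.inr (Or.inr (Or.inr (Or.inr
        ⟨L + R - d - x, by simpa using hx, L + R - d - y, by simpa using hy, by omega⟩)))
  left_left := fun hx hy => by have := T.left_left hy hx; omega
  right_right := fun hx hy => by have := T.right_right hy hx; omega
  left_right := fun hx hy => by have := T.left_right hx hy; omega
  mid_left := fun hx hy hx' => by have := T.mid_left hx hy hx'; omega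
  mid_right := fun hx hy hx' => by have := T.mid_right hx hy hx'; omega
  mid_mid := fun hx hy hx' hy' e => by
    have := T.mid_mid hx hy hx' hy' (by omega); omega

theorem first_mem (T : Tiling X Y d L R) : L ∈ X ∨ L ∈ Y := by
  obtain ⟨x, hx⟩ := T.nonempty_left
  have h0 := T.mem_left hx
  have hd := T.d_pos
  rcases T.cover L le_rfl (by omega) with h | h | h | h | ⟨x, hx, y, hy, e⟩
  · exact Or.inl h
  · have := T.mem_left h; omega
  · exact Or.inr h
  · have := T.mem_right h; omega
  · have := T.mem_left hx; have := T.mem_right hy; omega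

/-- If `d` were even, all elements of `X` and `Y` would be odd, and `2` could only be reached by the sum
`1 + 1`. -/
theorem parities (T : Tiling X Y d 1 N) (h1 : 1 ∈ X) :
    d % 2 = 1 ∧ (∀ x ∈ X, x % 2 = 1) ∧ ∀ y ∈ Y, y % 2 = 0 := by
  have hd := T.d_pos
  obtain ⟨y₀, hy₀⟩ := T.nonempty_right
  have hdodd : d % 2 = 1 := by
    by_contra hne
    have hX : ∀ x ∈ X, x % 2 = 1 := fun x hx => by
      have := T.parity hx hy₀; have := T.parity h1 hy₀; omega
    have hY : ∀ y ∈ Y, y % 2 = 1 := fun y hy => by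
      have := T.parity h1 hy; omega
    rcases T.cover 2 (by omega) (by have := T.mem_left h1; omega) with h | h | h | h | ⟨x, hx, y, hy, e⟩
    · have := hX _ h; omega
    · have := T.mem_left h; omega
    · have := hY _ h; omega
    · have := T.mem_right h; omega
    · have := T.mem_left hx; have := T.mem_right hy; have := T.left_right hx hy; omega
  exact ⟨hdodd, fun x hx => by have := T.parity hx hy₀; have := T.parity h1 hy₀; omega,
    fun y hy => by have := T.parity h1 hy; omega⟩

theorem two_mem (T : Tiling X Y d 1 N) (h1 : 1 ∈ X) (hd : 3 ≤ d) : 2 ∈ Y := by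
  obtain ⟨-, hX, hY⟩ := T.parities h1
  rcases T.cover 2 (by omega) (by have := T.mem_left h1; omega) with h | h | h | h | ⟨x, hx, y, hy, e⟩
  · have := hX _ h; omega
  · have := T.mem_left h; omega
  · exact h
  · have := T.mem_right h; omega
  · have := T.mem_left hx; have := T.mem_right hy; omega

theorem three_mem (T : Tiling X Y d 1 N) (h1 : 1 ∈ X) (hd : 5 ≤ d) : 3 ∈ X := by
  obtain ⟨-, hX, hY⟩ := T.parities h1
  rcases T.cover 3 (by omega) (by have := T.mem_left h1; omega) with h | h | h | h | ⟨x, hx, y, hy, e⟩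
  · exact h
  · have := T.mem_left h; omega
  · have := hY _ h; omega
  · have := T.mem_right h; omega
  · have := T.mem_left hx; have := T.mem_right hy; omega

theorem gap_eq_one_or_three_or_five (T : Tiling X Y d 1 N) (h1 : 1 ∈ X) : d = 1 ∨ d = 3 ∨ d = 5 := by
  obtain ⟨hd, hX, hY⟩ := T.parities h1
  have hd1 := T.d_pos
  by_contra hne
  have h2 := T.two_mem h1 (by omega)
  have h3 := T.three_mem h1 (by omega)
  rcases T.cover 4 (by omega) (by have := T.mem_left h1; omega) with h | h | h | h | ⟨x, hx, y, hy, e⟩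
  · have := hX _ h; omega
  · have := T.mem_left h; omega
  · have := T.mid_mid h1 h h3 h2; omega
  · have := T.mem_right h; omega
  · have := T.mem_left hx; have := T.mem_right hy; omega

theorem eq_of_gap_five (T : Tiling X Y 5 1 N) (h1 : 1 ∈ X) : N = 8 ∧ X = {1, 3} ∧ Y = {2} := by
  obtain ⟨-, hX, hY⟩ := T.parities h1
  have h2 := T.two_mem h1 (by omega)
  have h3 := T.three_mem h1 (by omega)
  have hN : N = 8 := by
    rcases T.reflect.first_mem with h | h
    · have h2' : 1 + N - 5 - 2 ∈ Y := T.reflect.two_mem h (by omega)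
      change 1 + N - 5 - 1 ∈ X at h
      have := T.mid_mid h3 h2' h h2 (by ring)
      omega
    · have h3' : 1 + N - 5 - 3 ∈ Y := T.reflect.swap.three_mem h (by omega)
      change 1 + N - 5 - 1 ∈ Y at h
      have := T.mid_mid h1 h h3 h3' (by ring)
      omega
  subst hN
  refine ⟨rfl, Set.ext fun x => ⟨fun hx => ?_, ?_⟩, Set.ext fun y => ⟨fun hy => ?_, ?_⟩⟩
  · have := T.mem_left hx; have := hX x hx
    simp only [Set.mem_insert_iff, Set.mem_singleton_iff]; omega
  · rintro (rfl | rfl) <;> assumption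
  · have := T.mem_right hy; have := hY y hy
    simp only [Set.mem_singleton_iff]; omega
  · rintro rfl; assumption

end Tiling
end UlrichPartition

/-! ### Tilings with gap three: the pattern after the smallest element -/

namespace UlrichPartition

theorem log_two_mul {k : ℕ} (hk : 1 ≤ k) : Nat.log 2 (2 * k) = Nat.log 2 k + 1 := by
  rw [Nat.log_of_one_lt_of_le (by norm_num) (by omega)]; congr 2; omega

theorem log_two_mul_add_one {k : ℕ} (hk : 1 ≤ k) : Nat.log 2 (2 * k + 1) = Nat.log 2 k + 1 := by
  rw [Nat.log_of_one_lt_of_le (by norm_num) (by omega)]; congr 2; omega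

/-- The solution of the recursion for `d = 3`, for elements `U` of which those below the origin are
only `-2 * e`. The maps `2 * m ↦ m` and `2 * m + 3 ↦ m` exchange the residues `e` and `3 - e` modulo
`3` and halve `w / 3` on multiples of `3`. -/
theorem pattern_of_gap_three {U : ℤ → Prop} {e : ℕ} {v : ℤ} (he : e = 1 ∨ e = 2)
    (heven : ∀ u, U u → u % 2 = 0) (h0 : ¬ U 0) (h2 : U (-2) ↔ e = 1)
    (rule : ∀ w, 1 ≤ w → w < v → ((U w ∨ U (w - 3)) ↔ ¬ U (2 * w))) :
    ∀ n : ℕ, 1 ≤ n → (n : ℤ) < 2 * v →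
      (n % 3 = e → (U n ∨ U (n - 3))) ∧ (n % 3 = 3 - e → ¬ (U n ∨ U (n - 3))) ∧
      ∀ k, n = 3 * k → ((U n ∨ U (n - 3)) ↔ Odd (Nat.log 2 k)) := by
  intro n
  induction n using Nat.strong_induction_on with
  | _ n ih =>
  intro hn hv
  rcases Nat.even_or_odd' n with ⟨m, hm | hm⟩
  · have hP : (U n ∨ U (n - 3)) ↔ ¬ (U m ∨ U (m - 3)) := by
      rw [rule m (by omega) (by omega), not_not]
      have : (n : ℤ) = 2 * m := by omega
      rw [this]
      refine ⟨fun h => h.resolve_right fun h' => ?_, Or.inl⟩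
      have := heven _ h'; omega
    obtain ⟨i1, i2, i3⟩ := ih m (by omega) (by omega) (by omega)
    rw [hP]
    refine ⟨fun h => i2 (by omega), fun h => not_not.2 (i1 (by omega)), fun k hk => ?_⟩
    obtain ⟨k', rfl⟩ : ∃ k', k = 2 * k' := ⟨k / 2, by omega⟩
    rw [i3 k' (by omega), log_two_mul (by omega), Nat.odd_add_one]
  · by_cases h1 : n = 1
    · subst h1
      have hP : (U (1 : ℕ) ∨ U ((1 : ℕ) - 3)) ↔ e = 1 := by
        rw [← h2]
        refine ⟨fun h => ?_, fun h => Or.inr h⟩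
        rcases h with h | h
        · have := heven _ h; omega
        · exact h
      rw [hP]
      refine ⟨fun h => by omega, fun h => by omega, fun k hk => by omega⟩
    obtain ⟨m, rfl⟩ : ∃ j, n = 2 * j + 3 := ⟨m - 1, by omega⟩
    have hP' : (U (2 * m + 3 : ℕ) ∨ U ((2 * m + 3 : ℕ) - 3)) ↔ U (2 * m) := by
      have e1 : ((2 * m + 3 : ℕ) : ℤ) - 3 = 2 * m := by push_cast; ring
      rw [e1]
      refine ⟨fun h => h.resolve_left fun h' => ?_, Or.inr⟩
      have := heven _ h'; omega
    rw [hP']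
    by_cases hm0 : m = 0
    · subst hm0
      refine ⟨fun h => by omega, fun h => by simpa using h0, fun k hk => ?_⟩
      obtain rfl : k = 1 := by omega
      simpa using h0
    have hP : U (2 * m) ↔ ¬ (U m ∨ U (m - 3)) := by
      rw [rule m (by omega) (by omega), not_not]
    obtain ⟨i1, i2, i3⟩ := ih m (by omega) (by omega) (by omega)
    rw [hP]
    refine ⟨fun h => i2 (by omega), fun h => not_not.2 (i1 (by omega)), fun k hk => ?_⟩
    obtain ⟨k', rfl⟩ : ∃ k', k = 2 * k' + 1 := ⟨k / 2, by omega⟩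
    rw [i3 k' (by omega), log_two_mul_add_one (by omega), Nat.odd_add_one]

/-- The parity of the binary logarithm changes from odd to even only at powers of `4`. -/
theorem exists_pow_of_log {k : ℕ} (hk : 1 ≤ k) (h1 : Odd (Nat.log 2 k))
    (h2 : ¬ Odd (Nat.log 2 (k + 1))) : ∃ j, k + 1 = 2 ^ (2 * j) ∧ 1 ≤ j := by
  have hlt := Nat.lt_pow_succ_log_self (b := 2) (by norm_num) k
  have hle := Nat.pow_log_le_self 2 (x := k) (by omega)
  have : k + 1 = 2 ^ (Nat.log 2 k + 1) := by
    by_contra hne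
    apply h2
    rwa [(Nat.log_eq_iff (m := Nat.log 2 k) (by omega)).2 ⟨by omega, by simp at *; omega⟩]
  obtain ⟨j, hj⟩ := h1
  exact ⟨j + 1, by rw [this, hj]; congr 1, by omega⟩

namespace Tiling

variable {X Y Z W : Set ℤ} {d L R N : ℤ}

set_option maxHeartbeats 2000000 in
/-- A tiling with `d = 3` in which `e ∈ Z` is the smallest element of `Z` and `z` the second: then
`z = 6 * k + e + 6` with `k` even of odd binary logarithm, and `W` is known up to about the place where
sums with `z` start. In coordinates counted from `e + 3`, even multiples `3 * i` of `3` with `Nat.log 2 i`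
odd lie in `W`, and numbers congruent to `-e` modulo `3` do not. -/
theorem second_of_gap_three {e : ℕ} (he : e = 1 ∨ e = 2) (T : Tiling Z W 3 1 N) (hZ : (e : ℤ) ∈ Z)
    (hW : (3 - e : ℤ) ∈ W) (h6 : (e + 9 : ℤ) ∈ W) (h1 : e = 1 → 8 ∈ W)
    (h2 : e = 2 → 7 ∈ W ∧ 13 ∈ W) {z : ℤ} (hz : z ∈ Z) (hez : e < z)
    (hmin : ∀ x ∈ Z, x = e ∨ z ≤ x) :
    ∃ k : ℕ, 2 ≤ k ∧ z = 6 * k + e + 6 ∧ k % 2 = 0 ∧ Odd (Nat.log 2 k) ∧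
      (∀ i : ℕ, 1 ≤ i → i % 2 = 0 → Odd (Nat.log 2 i) → 3 * i < 6 * k + 6 - 2 * e →
        (3 * i + (e + 3) : ℤ) ∈ W) ∧
      ∀ w : ℕ, 1 ≤ w → w < 6 * k + 6 - 2 * e → w % 3 = 3 - e → (w + (e + 3) : ℤ) ∉ W := by
  have T' := T.translate (e + 3)
  set U : ℤ → Prop := fun u => u + (e + 3) ∈ W with hUdef
  have toU : ∀ {u}, U u → u ∈ {u : ℤ | u + (e + 3) ∈ W} := fun h => h
  set Z' : Set ℤ := {u : ℤ | u + (e + 3) ∈ Z} with hZ'def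
  have m3 : (-3 : ℤ) ∈ Z' := by
    change (-3 : ℤ) + (e + 3) ∈ Z; convert hZ using 1; ring
  have hU6 : U 6 := by change (6 : ℤ) + (e + 3) ∈ W; convert h6 using 1; ring
  have hUm : U (-2 * e) := by change -2 * (e : ℤ) + (e + 3) ∈ W; convert hW using 1; ring
  -- the second element, in the new coordinates
  have hzodd : (z - (e + 3)) % 2 = 1 := by
    have := T.parity hz hW; omega
  obtain ⟨v, hv⟩ : ∃ v : ℤ, z - (e + 3) = 2 * v - 3 + 2 * e := ⟨(z - (e + 3) + 3 - 2 * e) / 2, by omega⟩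
  have hz' : 2 * v - 3 + 2 * (e : ℤ) ∈ Z' := by
    change _ + _ ∈ Z; convert hz using 1; omega
  have hmin' : ∀ x ∈ Z', x = -3 ∨ 2 * v - 3 + 2 * e ≤ x := fun x hx => by
    have := hmin _ hx; omega
  have hzodd' : ∀ x ∈ Z', x % 2 = 1 := fun x hx => by
    have := T'.parity hx (toU hUm); omega
  have heven : ∀ u, U u → u % 2 = 0 := fun u hu => by
    have := T'.parity m3 (toU hu); omega
  have h0 : ¬ U 0 := fun h => by have := T'.left_right m3 (toU h); omega
  have hneg : ∀ u, U u → u < 0 → u = -2 * e := fun u hu hlt => by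
    have := heven u hu; have := T'.mem_right (toU hu)
    rcases he with rfl | rfl
    · omega
    · have := T'.mid_right m3 (toU hUm) (toU hu); push_cast at *; omega
  have hU2 : U (-2) ↔ e = 1 := by
    refine ⟨fun h => ?_, fun h => by subst h; exact hUm⟩
    have := hneg _ h (by norm_num); omega
  have hR := T'.mem_left hz'
  have rule : ∀ w, 1 ≤ w → w < v → ((U w ∨ U (w - 3)) ↔ ¬ U (2 * w)) := fun w hw1 hwv => by
    constructor
    · rintro (h | h) h'
      · have := T'.mid_right m3 (toU h') (toU h); omega
      · have := T'.mid_right m3 (toU h') (toU h); omega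
    · intro h'
      rcases T'.cover w (by omega) (by omega) with h | h | h | h | ⟨x, hx, u, hu, e'⟩
      · have := hmin' _ h; omega
      · have := hmin' _ h; omega
      · exact Or.inl h
      · exact Or.inr h
      · rcases hmin' _ hx with rfl | h
        · exact absurd (show U (2 * w) by rwa [show 2 * w = u by omega]) h'
        · have : u < 0 ∨ 0 ≤ u := by omega
          rcases this with hlt | hge
          · have := hneg u hu hlt; omega
          · omega
  have pat := pattern_of_gap_three he heven h0 hU2 rule
  -- the sums with the second element
  have notP : ∀ w u : ℤ, U u → w = v + e + (u / 2) → ¬ (U w ∨ U (w - 3)) := fun w u hu hw h => by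
    have := heven u hu
    rcases h with h | h
    · have := T'.mid_right hz' (toU hu) (toU h); omega
    · have := T'.mid_right hz' (toU hu) (toU h); omega
  have hU4 : e = 1 → U 4 := fun h => by
    subst h; exact h1 rfl
  have hU28 : e = 2 → U 2 ∧ U 8 := fun h => by
    subst h; exact h2 rfl
  have hv1 : 1 ≤ v := by
    by_contra hlt
    have a1 := T'.mid_left hz' (toU hUm) m3
    have a2 := T'.left_right hz' (toU hUm)
    rcases he with rfl | rfl <;> push_cast at * <;> omega
  lift v to ℕ using by omega
  have hmod : v % 3 = e ∨ v % 3 = 0 ∨ v % 3 = 3 - e := by omega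
  rcases hmod with hmod | hmod | hmod
  · exact absurd ((pat v (by omega) (by omega)).1 hmod) (notP _ _ hUm (by omega))
  · exfalso
    by_cases hlt : e + 3 < v
    · have := (pat (v + e + 3) (by omega) (by omega)).1 (by omega)
      exact notP _ 6 hU6 (by push_cast; ring) this
    · obtain rfl : v = 3 := by omega
      rcases he with rfl | rfl
      · exact notP 7 6 hU6 (by norm_num) (Or.inr (hU4 rfl))
      · exact notP 8 6 hU6 (by norm_num) (Or.inl (hU28 rfl).2)
  obtain ⟨k, hk⟩ : ∃ k, v = 3 * k + 3 - e := ⟨v / 3, by omega⟩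
  have hk1 : 1 ≤ k := by
    by_contra hlt
    obtain rfl : k = 0 := by omega
    rcases he with rfl | rfl
    · have := T'.mid_mid hz' (toU hUm) m3 (toU (hU4 rfl)) (by push_cast; omega)
      omega
    · have := T'.mid_mid hz' (toU hUm) m3 (toU (hU28 rfl).1) (by push_cast; omega)
      omega
  -- `3 (k + 1)` is the middle of the first two elements, shifted by `3`: only a direct covering is left
  have hPk1 : U (3 * (k + 1)) ∨ U (3 * (k + 1) - 3) := by
    rcases T'.cover (3 * (k + 1)) (by omega) (by omega) with h | h | h | h | ⟨x, hx, u, hu, e'⟩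
    · have := hmin' _ h; omega
    · have := hmin' _ h; omega
    · exact Or.inl h
    · exact Or.inr h
    · exfalso
      rcases hmin' _ hx with rfl | h
      · have := T'.left_right hz' hu; omega
      · have hu0 : u ≠ 0 := by rintro rfl; exact h0 hu
        have hlt : u < 0 := by
          by_contra hge
          have := heven u hu; omega
        have hue := hneg u hu hlt
        -- a third element, at distance `2 e` from the second
        have hx' : x = 6 * k + 3 + 2 * e := by omega
        by_cases hke : e < k
        · have hP := (pat (3 * (k + 2) + e) (by omega) (by omega)).1 (by omega)
          rcases hP with h' | h'
          · have := T'.mid_right hx (toU hU6) (toU h'); push_cast at *; omega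
          · have := T'.mid_right hx (toU hU6) (toU h'); push_cast at *; omega
        · rcases (by omega : k = 1 ∨ (k = 2 ∧ e = 2)) with rfl | ⟨rfl, rfl⟩
          · have := T'.mid_right hx hu (toU hU6); push_cast at *; omega
          · have := T'.mid_right hx hu (toU hU6); push_cast at *; omega
  have hnP2 : ¬ (U (3 * (k + 2)) ∨ U (3 * (k + 2) - 3)) :=
    notP _ 6 hU6 (by push_cast; omega)
  have hk2 : 2 ≤ k := by
    by_contra hlt
    obtain rfl : k = 1 := by omega
    exact hnP2 (Or.inr (by norm_num; exact hU6))
  have hlog1 : Odd (Nat.log 2 (k + 1)) :=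
    ((pat (3 * (k + 1)) (by omega) (by omega)).2.2 _ rfl).1 (by push_cast; exact hPk1)
  have hlog2 : ¬ Odd (Nat.log 2 (k + 1 + 1)) := fun h =>
    hnP2 (by
      have := ((pat (3 * (k + 2)) (by omega) (by omega)).2.2 _ rfl).2 h
      push_cast at this; exact this)
  obtain ⟨j, hj, hj1⟩ := exists_pow_of_log (by omega) hlog1 hlog2
  have hlogk : Odd (Nat.log 2 k) := by
    obtain ⟨i, rfl⟩ : ∃ i, j = i + 1 := ⟨j - 1, by omega⟩
    have hp : 2 ^ (2 * (i + 1)) = 2 * 2 ^ (2 * i + 1) := by ring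
    have : Nat.log 2 k = 2 * i + 1 := by
      rw [Nat.log_eq_iff (by omega)]
      constructor
      · have : 2 ^ 1 ≤ 2 ^ (2 * i + 1) := Nat.pow_le_pow_right (by norm_num) (by omega)
        omega
      · rw [pow_succ]; omega
    rw [this]; exact ⟨i, rfl⟩
  have hkeven : k % 2 = 0 := by
    obtain ⟨i, rfl⟩ : ∃ i, j = i + 1 := ⟨j - 1, by omega⟩
    have hp : 2 ^ (2 * (i + 1)) = 2 * 2 ^ (2 * i + 1) := by ring
    omega
  refine ⟨k, hk2, by omega, hkeven, hlogk, fun i hi1 hi2 hi hik => ?_, fun w hw hwk hwe hmem => ?_⟩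
  · rcases ((pat (3 * i) (by omega) (by omega)).2.2 _ rfl).2 hi with h | h
    · change _ + _ ∈ W at h
      convert h using 1; push_cast; ring
    · have := heven _ h; omega
  · exact (pat w hw (by omega)).2.1 hwe (Or.inl hmem)

end Tiling
end UlrichPartition

/-! ### Classification of the tilings with gap three -/

namespace UlrichPartition

/-- A set of integers that is bounded below, with smallest element `a` and another element, has a second
smallest one. -/
theorem exists_second {Z : Set ℤ} {L a b : ℤ} (hL : ∀ x ∈ Z, L ≤ x) (hb : b ∈ Z) (hba : b ≠ a)
    (ha : ∀ x ∈ Z, a ≤ x) :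
    ∃ z ∈ Z, a < z ∧ ∀ x ∈ Z, x = a ∨ z ≤ x := by
  obtain ⟨z, ⟨hz, hza⟩, hmin⟩ := Int.exists_least_of_bdd (P := fun x => x ∈ Z ∧ x ≠ a)
    ⟨L, fun x hx => hL x hx.1⟩ ⟨b, hb, hba⟩
  refine ⟨z, hz, lt_of_le_of_ne (ha z hz) (Ne.symm hza), fun x hx => ?_⟩
  by_cases h : x = a
  · exact Or.inl h
  · exact Or.inr (hmin x ⟨hx, h⟩)

namespace Tiling

variable {X Y Z W : Set ℤ} {d L R N : ℤ}

/-- The two initial configurations, `e = 1` and `e = 2`, of a tiling with `d = 3` that are not already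
complete tilings: `e` and `3 - e` start `Z` and `W`, and `W` has further small elements. -/
def StartsThree (Z W : Set ℤ) (e : ℕ) : Prop :=
  (e : ℤ) ∈ Z ∧ (3 - e : ℤ) ∈ W ∧ (e + 9 : ℤ) ∈ W ∧ (e = 1 → 8 ∈ W) ∧ (e = 2 → 7 ∈ W ∧ 13 ∈ W)

theorem le_of_startsThree {e : ℕ} (he : e = 1 ∨ e = 2) (T : Tiling Z W 3 1 N) (S : StartsThree Z W e) :
    ∀ x ∈ Z, (e : ℤ) ≤ x := fun x hx => by
  have := T.mem_left hx
  have := T.parity hx S.2.1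
  omega

/-- The smaller of the second elements at the two ends, `z`, makes two sums coincide: that of `z` with
the element with coordinate `3 * k` counted from the right end, and that of the largest element of `Z`
with the element with coordinate `3 * k` counted from the left. -/
theorem false_of_startsThree_of_le {e : ℕ} (he : e = 1 ∨ e = 2) (T : Tiling Z W 3 1 N)
    (S : StartsThree Z W e)
    (S' : StartsThree {u | 1 + N - 3 - u ∈ Z} {u | 1 + N - 3 - u ∈ W} e) {z z' : ℤ}
    (hz : z ∈ Z) (hez : e < z) (hmin : ∀ x ∈ Z, x = e ∨ z ≤ x)
    (hz' : 1 + N - 3 - z' ∈ Z) (hez' : e < z')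
    (hmin' : ∀ x, 1 + N - 3 - x ∈ Z → x = e ∨ z' ≤ x) (hle : z ≤ z') : False := by
  obtain ⟨k, hk2, hk, hkeven, hklog, hW, hnot⟩ :=
    T.second_of_gap_three he S.1 S.2.1 S.2.2.1 S.2.2.2.1 S.2.2.2.2 hz hez hmin
  obtain ⟨k', hk2', hk', hkeven', hklog', hW', hnot'⟩ :=
    T.reflect.second_of_gap_three he S'.1 S'.2.1 S'.2.2.1 S'.2.2.2.1 S'.2.2.2.2 hz' hez' hmin'
  have a := hW k (by omega) hkeven hklog (by omega)
  have b := hW' k (by omega) hkeven hklog (by omega)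
  have c := S'.1
  change 1 + N - 3 - _ ∈ W at b
  change 1 + N - 3 - _ ∈ Z at c
  have hzN := T.mid_mid hz b c a (by omega)
  have hsmall : ∀ w : ℤ, 1 ≤ w → w < 6 * k + 6 - 2 * e → w % 3 = 3 - e → w + (e + 3) ∉ W := by
    intro w h1 h2 h3
    lift w to ℕ using by omega
    exact hnot w (by omega) (by omega) (by omega)
  rcases he with rfl | rfl
  · have h := S'.2.2.2.1 rfl
    change 1 + N - 3 - _ ∈ W at h
    refine hsmall (6 * k - 4) (by omega) (by omega) (by omega) ?_
    convert h using 1; push_cast at *; omega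
  · have h := (S'.2.2.2.2 rfl).1
    change 1 + N - 3 - _ ∈ W at h
    refine hsmall (6 * k - 2) (by omega) (by omega) (by omega) ?_
    convert h using 1; push_cast at *; omega

theorem false_of_startsThree {e : ℕ} (he : e = 1 ∨ e = 2) (T : Tiling Z W 3 1 N)
    (S : StartsThree Z W e)
    (S' : StartsThree {u | 1 + N - 3 - u ∈ Z} {u | 1 + N - 3 - u ∈ W} e) : False := by
  have hN := T.mem_right S.2.2.1
  obtain ⟨z, hz, hez, hmin⟩ := exists_second (fun x hx => (T.mem_left hx).1) S'.1 (by omega)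
    (T.le_of_startsThree he S)
  obtain ⟨z', hz', hez', hmin'⟩ := exists_second (fun x hx => (T.reflect.mem_left hx).1)
    (b := 1 + N - 3 - e) (by
      change 1 + N - 3 - (1 + N - 3 - e) ∈ Z
      convert S.1 using 1; ring) (by omega)
    (T.reflect.le_of_startsThree he S')
  rcases le_total z z' with h | h
  · exact T.false_of_startsThree_of_le he S S' hz hez hmin hz' hez' hmin' h
  · have hrr : ∀ A : Set ℤ, {u : ℤ | 1 + N - 3 - u ∈ {u | 1 + N - 3 - u ∈ A}} = A := fun A => by
      ext u; simp
    refine T.reflect.false_of_startsThree_of_le he S' ?_ hz' hez' hmin' (z' := z) ?_ hez ?_ h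
    · rw [hrr, hrr]; exact S
    · change 1 + N - 3 - (1 + N - 3 - z) ∈ Z
      convert hz using 1; ring
    · intro x hx
      change 1 + N - 3 - (1 + N - 3 - x) ∈ Z at hx
      exact hmin x (by convert hx using 1; ring)

theorem start_cases_of_gap_three (T : Tiling X Y 3 1 N) (h1 : 1 ∈ X) (hN : 6 ≤ N) :
    2 ∈ Y ∧ ((8 ∈ Y ∧ 10 ∈ Y) ∨ (8 ∈ Y ∧ 9 ∈ X) ∨ (7 ∈ X ∧ 12 ∈ Y ∧ 13 ∈ X) ∨
      (7 ∈ X ∧ 11 ∈ X ∧ 13 ∈ X)) := by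
  obtain ⟨-, hX, hY⟩ := T.parities h1
  have h2 := T.two_mem h1 (by omega)
  have x3 : 3 ∉ X := fun h => by have := T.mid_left h1 h2 h; omega
  have x5 : 5 ∉ X := fun h => by have := T.left_right h h2; omega
  have y4 : 4 ∉ Y := fun h => by have := T.left_right h1 h; omega
  have y6 : 6 ∉ Y := fun h => by have := T.mid_right h1 h h2; omega
  refine ⟨h2, ?_⟩
  have c6 : 8 ∈ Y ∨ 7 ∈ X := by
    rcases T.cover 6 (by omega) hN with h | h | h | h | ⟨x, hx, y, hy, e⟩
    · have := hX _ h; omega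
    · exact absurd h x3
    · exact absurd h y6
    · have := hY _ h; omega
    · have b1 := T.mem_left hx
      have b2 := T.mem_right hy
      have b3 := hX _ hx
      obtain rfl : y = 9 - x := by omega
      have : x = 1 ∨ x = 3 ∨ x = 5 ∨ x = 7 := by omega
      rcases this with rfl | rfl | rfl | rfl
      · exact Or.inl hy
      · exact absurd hx x3
      · exact absurd hx x5
      · exact Or.inr hx
  by_cases h8 : 8 ∈ Y
  · have hN := T.mem_right h8
    have x7 : 7 ∉ X := fun h => by have := T.mid_mid h1 h8 h h2; omega
    rcases T.cover 7 (by omega) (by omega) with h | h | h | h | ⟨x, hx, y, hy, e⟩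
    · exact absurd h x7
    · have := hX _ h; omega
    · have := hY _ h; omega
    · exact absurd h y4
    · have b1 := T.mem_left hx
      have b2 := T.mem_right hy
      have b3 := hX _ hx
      obtain rfl : y = 11 - x := by omega
      have : x = 1 ∨ x = 3 ∨ x = 5 ∨ x = 7 ∨ x = 9 := by omega
      rcases this with rfl | rfl | rfl | rfl | rfl
      · exact Or.inl ⟨h8, hy⟩
      · exact absurd hx x3
      · exact absurd hx x5
      · exact absurd hx x7
      · exact Or.inr (Or.inl ⟨h8, hx⟩)
  · have h7 := c6.resolve_left h8
    have hN := T.mem_left h7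
    have y10 : 10 ∉ Y := fun h => by have := T.left_right h7 h; omega
    have x9 : 9 ∉ X := fun h => by have := T.mid_left h h2 h7; omega
    have c8 : 12 ∈ Y ∨ 11 ∈ X := by
      rcases T.cover 8 (by omega) (by omega) with h | h | h | h | ⟨x, hx, y, hy, e⟩
      · have := hX _ h; omega
      · exact absurd h x5
      · exact absurd h h8
      · have := hY _ h; omega
      · have b1 := T.mem_left hx
        have b2 := T.mem_right hy
        have b3 := hX _ hx
        obtain rfl : y = 13 - x := by omega
        have : x = 1 ∨ x = 3 ∨ x = 5 ∨ x = 7 ∨ x = 9 ∨ x = 11 := by omega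
        rcases this with rfl | rfl | rfl | rfl | rfl | rfl
        · exact Or.inl hy
        · exact absurd hx x3
        · exact absurd hx x5
        · exact absurd hy y6
        · exact absurd hx x9
        · exact Or.inr hx
    have y14 : 14 ∉ Y := fun h => by
      rcases c8 with h' | h'
      · have := T.mid_right h7 h h'; omega
      · have := T.left_right h' h; omega
    have h13 : 13 ∈ X := by
      rcases T.cover 9 (by omega) (by omega) with h | h | h | h | ⟨x, hx, y, hy, e⟩
      · exact absurd h x9
      · have := hX _ h; omega
      · have := hY _ h; omega
      · exact absurd h y6
      · have b1 := T.mem_left hx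
        have b2 := T.mem_right hy
        have b3 := hX _ hx
        obtain rfl : y = 15 - x := by omega
        have : x = 1 ∨ x = 3 ∨ x = 5 ∨ x = 7 ∨ x = 9 ∨ x = 11 ∨ x = 13 := by omega
        rcases this with rfl | rfl | rfl | rfl | rfl | rfl | rfl
        · exact absurd hy y14
        · exact absurd hx x3
        · exact absurd hx x5
        · exact absurd hy h8
        · exact absurd hx x9
        · exact absurd hy y4
        · exact hx
    rcases c8 with h | h
    · exact Or.inr (Or.inr (Or.inl ⟨h7, h, h13⟩))
    · exact Or.inr (Or.inr (Or.inr ⟨h7, h, h13⟩))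

theorem eq_of_gap_three (T : Tiling X Y 3 1 N) (h1 : 1 ∈ X) :
    (N = 5 ∧ X = {1} ∧ Y = {2}) ∨ (N = 12 ∧ X = {1, 9} ∧ Y = {2, 8}) ∨
      (N = 16 ∧ X = {1, 7, 13} ∧ Y = {2, 12}) := by
  obtain ⟨-, hX, hY⟩ := T.parities h1
  have h2 := T.two_mem h1 (by omega)
  have hN5 := T.mem_right h2
  by_cases hN : N = 5
  · subst hN
    refine Or.inl ⟨rfl, Set.ext fun x => ⟨fun hx => ?_, ?_⟩, Set.ext fun y => ⟨fun hy => ?_, ?_⟩⟩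
    · have := T.mem_left hx; have := hX x hx
      simp only [Set.mem_singleton_iff]; omega
    · rintro rfl; assumption
    · have := T.mem_right hy; have := hY y hy
      simp only [Set.mem_singleton_iff]; omega
    · rintro rfl; assumption
  have TR := T.reflect
  rcases T.reflect.first_mem with hR1 | hR1
  swap
  · have h2R : 1 + N - 3 - 2 ∈ X := T.reflect.swap.two_mem hR1 (by omega)
    change 1 + N - 3 - 1 ∈ Y at hR1
    have := T.mid_mid h1 hR1 h2R h2 (by ring); omega
  obtain ⟨-, hc⟩ := T.start_cases_of_gap_three h1 (by omega)
  obtain ⟨h2R, hcR⟩ := T.reflect.start_cases_of_gap_three hR1 (by omega)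
  have hR1' : 1 + N - 3 - 1 ∈ X := hR1
  have h2R' : 1 + N - 3 - 2 ∈ Y := h2R
  rcases hc with ⟨h8, h10⟩ | ⟨h8, h9⟩ | ⟨h7, h12, h13⟩ | ⟨h7, h11, h13⟩
  · rcases hcR with ⟨r8, r10⟩ | ⟨r8, r9⟩ | ⟨r7, r12, r13⟩ | ⟨r7, r11, r13⟩
    · exact (T.false_of_startsThree (e := 1) (Or.inl rfl) ⟨h1, h2, h10, fun _ => h8, by omega⟩
        ⟨hR1, h2R, r10, fun _ => r8, by omega⟩).elim
    · change 1 + N - 3 - _ ∈ Y at r8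
      change 1 + N - 3 - _ ∈ X at r9
      have := T.mid_mid h1 r8 r9 h2 (by ring)
      have := T.mem_right h10; omega
    · change 1 + N - 3 - _ ∈ X at r7
      have := T.mid_mid hR1' h2 r7 h8 (by ring); omega
    · change 1 + N - 3 - _ ∈ X at r7
      have := T.mid_mid hR1' h2 r7 h8 (by ring); omega
  · have := T.mid_mid h9 h2R' hR1' h8 (by ring)
    obtain rfl : N = 12 := by omega
    have y4 : 4 ∉ Y := fun h => by have := T.left_right h1 h; omega
    have y6 : 6 ∉ Y := fun h => by have := T.mid_right h1 h h2; omega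
    have x3 : 3 ∉ X := fun h => by have := T.mid_left h1 h2 h; omega
    have x5 : 5 ∉ X := fun h => by have := T.left_right h h2; omega
    have x7 : 7 ∉ X := fun h => by have := T.mid_mid h1 h8 h h2; omega
    refine Or.inr (Or.inl ⟨rfl, Set.ext fun x => ⟨fun hx => ?_, ?_⟩,
      Set.ext fun y => ⟨fun hy => ?_, ?_⟩⟩)
    · have := T.mem_left hx; have := hX x hx
      have : x = 1 ∨ x = 3 ∨ x = 5 ∨ x = 7 ∨ x = 9 := by omega
      rcases this with rfl | rfl | rfl | rfl | rfl <;> simp <;> contradiction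
    · rintro (rfl | rfl) <;> assumption
    · have := T.mem_right hy; have := hY y hy
      have : y = 2 ∨ y = 4 ∨ y = 6 ∨ y = 8 := by omega
      rcases this with rfl | rfl | rfl | rfl <;> simp <;> contradiction
    · rintro (rfl | rfl) <;> assumption
  · have := T.mid_mid h13 h2R' hR1' h12 (by ring)
    obtain rfl : N = 16 := by omega
    have y4 : 4 ∉ Y := fun h => by have := T.left_right h1 h; omega
    have y6 : 6 ∉ Y := fun h => by have := T.mid_right h1 h h2; omega
    have y8 : 8 ∉ Y := fun h => by have := T.mid_mid h1 h h7 h2; omega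
    have y10 : 10 ∉ Y := fun h => by have := T.left_right h7 h; omega
    have x3 : 3 ∉ X := fun h => by have := T.mid_left h1 h2 h; omega
    have x5 : 5 ∉ X := fun h => by have := T.left_right h h2; omega
    have x9 : 9 ∉ X := fun h => by have := T.mid_left h h2 h7; omega
    have x11 : 11 ∉ X := fun h => by have := T.mid_mid h h2 h1 h12; omega
    refine Or.inr (Or.inr ⟨rfl, Set.ext fun x => ⟨fun hx => ?_, ?_⟩,
      Set.ext fun y => ⟨fun hy => ?_, ?_⟩⟩)
    · have := T.mem_left hx; have := hX x hx
      have : x = 1 ∨ x = 3 ∨ x = 5 ∨ x = 7 ∨ x = 9 ∨ x = 11 ∨ x = 13 := by omega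
      rcases this with rfl | rfl | rfl | rfl | rfl | rfl | rfl <;> simp <;> contradiction
    · rintro (rfl | rfl | rfl) <;> assumption
    · have := T.mem_right hy; have := hY y hy
      have : y = 2 ∨ y = 4 ∨ y = 6 ∨ y = 8 ∨ y = 10 ∨ y = 12 := by omega
      rcases this with rfl | rfl | rfl | rfl | rfl | rfl <;> simp <;> contradiction
    · rintro (rfl | rfl) <;> assumption
  · rcases hcR with ⟨r8, r10⟩ | ⟨r8, r9⟩ | ⟨r7, r12, r13⟩ | ⟨r7, r11, r13⟩
    · change 1 + N - 3 - _ ∈ Y at r8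
      have := T.mid_mid h7 r8 h1 h2R' (by ring); omega
    · change 1 + N - 3 - _ ∈ Y at r8
      have := T.mid_mid h7 r8 h1 h2R' (by ring); omega
    · change 1 + N - 3 - _ ∈ Y at r12
      change 1 + N - 3 - _ ∈ X at r13
      have := T.mid_mid h1 r12 r13 h2 (by ring)
      have : N = 16 := by omega
      subst this
      have := T.mid_mid h11 h2 h1 h2R' (by ring); omega
    · exact (T.swap.false_of_startsThree (e := 2) (Or.inr rfl) ⟨h2, h1, h11, by omega, fun _ => ⟨h7, h13⟩⟩
        ⟨h2R, hR1, r11, by omega, fun _ => ⟨r7, r13⟩⟩).elim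

end Tiling
end UlrichPartition

/-! ### Logarithmic patterns for gap one -/

namespace UlrichPartition

/-- The solution of the recursion for `d = 1` to the right of the origin. -/
theorem pattern_pos {U : ℤ → Prop} {v : ℤ} (heven : ∀ u, U u → u % 2 = 0) (h0 : ¬ U 0)
    (rule : ∀ w, 1 ≤ w → w < v → ((U w ∨ U (w - 1)) ↔ ¬ U (2 * w))) :
    ∀ n : ℕ, 1 ≤ n → (n : ℤ) < 2 * v → ((U n ∨ U (n - 1)) ↔ Odd (Nat.log 2 n)) := by
  intro n
  induction n using Nat.strong_induction_on with
  | _ n ih =>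
  intro hn hv
  by_cases h1 : n = 1
  · subst h1
    have hU1 : ¬ U 1 := fun h => by have := heven _ h; omega
    simp [h0, hU1]
  obtain ⟨m, hm1, hm⟩ : ∃ m : ℕ, 1 ≤ m ∧ (n = 2 * m ∨ n = 2 * m + 1) := ⟨n / 2, by omega, by omega⟩
  have hlog : Nat.log 2 n = Nat.log 2 m + 1 := by
    rcases hm with rfl | rfl
    · exact log_two_mul hm1
    · exact log_two_mul_add_one hm1
  have hP : (U n ∨ U (n - 1)) ↔ U (2 * m) := by
    rcases hm with rfl | rfl
    · push_cast
      refine ⟨fun h => h.resolve_right fun h' => ?_, Or.inl⟩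
      have := heven _ h'; omega
    · push_cast
      rw [add_sub_cancel_right]
      refine ⟨fun h => h.resolve_left fun h' => ?_, Or.inr⟩
      have := heven _ h'; omega
  rw [hP, hlog, Nat.odd_add_one, ← ih m (by omega) hm1 (by omega), rule m (by omega) (by omega),
    not_not]

theorem clog_two_mul {k : ℕ} (hk : 1 ≤ k) : Nat.clog 2 (2 * k) = Nat.clog 2 k + 1 := by
  rw [Nat.clog_of_two_le (by norm_num) (by omega)]; congr 2; omega

theorem clog_two_mul_sub_one {k : ℕ} (hk : 2 ≤ k) : Nat.clog 2 (2 * k - 1) = Nat.clog 2 k + 1 := by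
  rw [Nat.clog_of_two_le (by norm_num) (by omega)]; congr 2; omega

/-- The solution of the recursion for `d = 1` to the left of the origin; `-1` is the base element itself. -/
theorem pattern_neg {U : ℤ → Prop} {K : ℤ} (heven : ∀ u, U u → u % 2 = 0) (h2 : ¬ U (-2))
    (rule : ∀ m, 2 ≤ m → m ≤ K → ((U (-m) ∨ U (-m - 1)) ↔ ¬ U (-(2 * m)))) :
    ∀ n : ℕ, 2 ≤ n → (n : ℤ) ≤ K → ((U (-n) ∨ U (-n - 1)) ↔ Even (Nat.clog 2 n)) := by
  intro n
  induction n using Nat.strong_induction_on with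
  | _ n ih =>
  intro hn hv
  by_cases h1 : n = 2
  · subst h1
    have hU3 : ¬ U (-3) := fun h => by have := heven _ h; omega
    have : Nat.clog 2 2 = 1 := by simp [Nat.clog_of_two_le]
    rw [this]
    simp only [Nat.cast_ofNat, h2, false_or]
    norm_num [hU3]
  obtain ⟨m, hm1, hm⟩ : ∃ m : ℕ, 2 ≤ m ∧ (n = 2 * m ∨ n = 2 * m - 1) :=
    ⟨(n + 1) / 2, by omega, by omega⟩
  have hlog : Nat.clog 2 n = Nat.clog 2 m + 1 := by
    rcases hm with rfl | rfl
    · exact clog_two_mul (by omega)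
    · exact clog_two_mul_sub_one hm1
  have hP : (U (-n) ∨ U (-n - 1)) ↔ U (-(2 * m)) := by
    rcases hm with rfl | rfl
    · push_cast
      refine ⟨fun h => h.resolve_right fun h' => ?_, Or.inl⟩
      have := heven _ h'; omega
    · have e1 : (-((2 * m - 1 : ℕ) : ℤ) - 1) = -(2 * m) := by omega
      rw [e1]
      refine ⟨fun h => h.resolve_left fun h' => ?_, Or.inr⟩
      have := heven _ h'; omega
  rw [hP, hlog, Nat.even_add_one, ← ih m (by omega) hm1 (by omega), rule m (by omega) (by omega),
    not_not]

theorem odd_log_iff {p w : ℕ} (h1 : 4 ^ p ≤ w) (h2 : w < 4 * 4 ^ p) :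
    Odd (Nat.log 2 w) ↔ 2 * 4 ^ p ≤ w := by
  have e : (4 : ℕ) ^ p = 2 ^ (2 * p) := by rw [pow_mul]; norm_num
  have hw : w ≠ 0 := by have : 0 < 4 ^ p := by positivity
                        omega
  constructor
  · intro h
    by_contra hlt
    rw [(Nat.log_eq_iff (m := 2 * p) (Or.inr ⟨by norm_num, hw⟩)).2
      ⟨by omega, by rw [pow_succ]; omega⟩] at h
    exact Nat.not_odd_iff_even.2 (even_two_mul p) h
  · intro h
    rw [(Nat.log_eq_iff (m := 2 * p + 1) (Or.inr ⟨by norm_num, hw⟩)).2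
      ⟨by rw [pow_succ]; omega, by rw [pow_succ, pow_succ]; omega⟩]
    exact ⟨p, rfl⟩

/-- Numbers in `(K / 2, K]` with even upper logarithm only: if `K` is not a power of `2`, the largest power
of `2` below `K` lies in the range and has upper logarithm one less than that of `K`. -/
theorem exists_four_pow_of_clog {K : ℕ} (hK : 1 ≤ K)
    (h : ∀ m, K < 2 * m → m ≤ K → Even (Nat.clog 2 m)) : ∃ n, K = 4 ^ n := by
  have hle := Nat.le_pow_clog (b := 2) (by norm_num) K
  obtain ⟨j, hj⟩ := h K (by omega) le_rfl
  refine ⟨j, ?_⟩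
  have e : (4 : ℕ) ^ j = 2 ^ Nat.clog 2 K := by
    rw [hj, ← two_mul, pow_mul]; norm_num
  rw [e]
  by_contra hne
  have hK1 : 1 < K := by
    by_contra hlt
    obtain rfl : K = 1 := by omega
    simp at hne
  have hlt := Nat.pow_pred_clog_lt_self (b := 2) (by norm_num) hK1
  have hpos : Nat.clog 2 K ≠ 0 := by
    intro h0; rw [h0] at hle; simp at hle; omega
  obtain ⟨i, hi⟩ := Nat.exists_eq_succ_of_ne_zero hpos
  rw [hi, Nat.pred_succ] at hlt
  have := h (2 ^ i) (by rw [hi, pow_succ] at hle hne; omega) hlt.le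
  rw [Nat.clog_pow _ _ (by norm_num)] at this
  have h2 : Even (Nat.clog 2 K) := ⟨j, hj⟩
  rw [hi] at h2
  exact (Nat.even_add_one.1 h2) this

namespace Tiling

variable {X Y Z W : Set ℤ} {d L R N : ℤ}

/-- The recursion for `d = 1`, in coordinates where the base element of `Y` is `-1`: up to `v`, where sums
with other elements of `Y` start, the position `w` is either in `X ∪ (X + 1)` or the half of an element
of `X`, but not both. -/
theorem mem_or_mem_iff_of_base {v w : ℤ} (T : Tiling X Y 1 L R) (hb : -1 ∈ Y)
    (hv : ∀ y ∈ Y, y = -1 ∨ (v ≤ y ∧ ∀ x ∈ X, 2 * v ≤ x + y + 1))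
    (hL : L ≤ w) (hR : w ≤ R) (hwv : w < v) (h0 : w ≠ 0) (h1 : w ≠ -1) :
    (w ∈ X ∨ w - 1 ∈ X) ↔ ¬ 2 * w ∈ X := by
  constructor
  · rintro (h | h) h'
    · have := T.mid_left h' hb h; omega
    · have := T.mid_left h' hb h; omega
  · intro h'
    rcases T.cover w hL hR with h | h | h | h | ⟨x, hx, y, hy, e⟩
    · exact Or.inl h
    · exact Or.inr h
    · have := hv _ h; omega
    · have := hv _ h; omega
    · rcases hv _ hy with rfl | ⟨-, h⟩
      · exact absurd (show 2 * w ∈ X by rwa [show 2 * w = x by omega]) h'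
      · have := h x hx; omega

/-- For `d = 1` the positions up to half the smallest element `y₁` of `Y` are covered by an initial run of
`X`. The sums of this run with another element `y < 8 * a + 2` of `Y` would hit `y₁`, `y₁ + 1` or a sum
with `y₁`. -/
theorem exists_initial_run (T : Tiling X Y 1 1 N) (h1 : 1 ∈ X) {y₁ : ℤ} (hy₁ : y₁ ∈ Y)
    (hmin : ∀ y ∈ Y, y₁ ≤ y) :
    ∃ a : ℤ, 1 ≤ a ∧ y₁ = 4 * a ∧ (∀ i, 0 ≤ i → i < a → 2 * i + 1 ∈ X) ∧
      ∀ y ∈ Y, y = y₁ ∨ 8 * a + 2 ≤ y := by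
  obtain ⟨-, hX, hY⟩ := T.parities h1
  have hb := T.mem_right hy₁
  have hy₁' := hY _ hy₁
  have run : ∀ n, 1 ≤ n → 2 * n ≤ y₁ → n ∈ X ∨ n - 1 ∈ X := fun n h1 h2 => by
    rcases T.cover n h1 (by omega) with h | h | h | h | ⟨x, hx, y, hy, e⟩
    · exact Or.inl h
    · exact Or.inr h
    · have := hmin _ h; omega
    · have := hmin _ h; omega
    · have := hmin _ hy; have := T.mem_left hx; omega
  have h4 : y₁ % 4 = 0 := by
    by_contra hne
    rcases run (y₁ / 2) (by omega) (by omega) with h | h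
    · have := T.mid_left h1 hy₁ h; omega
    · have := hX _ h; omega
  obtain ⟨a, rfl⟩ : ∃ a, y₁ = 4 * a := ⟨y₁ / 4, by omega⟩
  have hI : ∀ i, 0 ≤ i → i < a → 2 * i + 1 ∈ X := fun i hi hia => by
    rcases run (2 * i + 1) (by omega) (by omega) with h | h
    · exact h
    · have := hX _ h; omega
  refine ⟨a, by omega, rfl, hI, fun y hy => ?_⟩
  by_cases hyy : y = 4 * a
  · exact Or.inl hyy
  right
  have hlo := hmin y hy
  have hyev := hY y hy
  obtain ⟨j, rfl⟩ : ∃ j, y = 2 * j := ⟨y / 2, by omega⟩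
  by_contra hlt
  rcases (by omega : j < 3 * a ∨ (3 * a ≤ j ∧ j < 4 * a) ∨ j = 4 * a) with h | h | h
  · have := T.mid_mid h1 hy (hI (j - 2 * a) (by omega) (by omega)) hy₁ (by ring)
    omega
  · have := T.mid_right (hI (4 * a - 1 - j) (by omega) (by omega)) hy hy₁
    omega
  · have := T.mid_right h1 hy hy₁; omega

/-- Since doubles of `m > y₁ / 2` leave the interval, the recursion to the left of the origin forces `y₁`
to be a power of `4`. -/
theorem least_eq_four_pow (T : Tiling X Y 1 1 N) (h1 : 1 ∈ X) {y₁ : ℤ} (hy₁ : y₁ ∈ Y)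
    (hmin : ∀ y ∈ Y, y₁ ≤ y) :
    ∃ n : ℕ, y₁ = 4 * 4 ^ n ∧ (∀ i : ℤ, 0 ≤ i → i < 4 ^ n → 2 * i + 1 ∈ X) ∧
      (∀ y ∈ Y, y = y₁ ∨ 8 * 4 ^ n + 2 ≤ y) ∧
      ∀ m : ℕ, 2 ≤ m → (m : ℤ) ≤ y₁ →
        ((-(m : ℤ) + (y₁ + 1) ∈ X ∨ -(m : ℤ) - 1 + (y₁ + 1) ∈ X) ↔ Even (Nat.clog 2 m)) := by
  obtain ⟨a, ha, rfl, hI, hY⟩ := T.exists_initial_run h1 hy₁ hmin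
  obtain ⟨-, hXp, -⟩ := T.parities h1
  have hlo := T.mem_right hy₁
  have T' := T.translate (4 * a + 1)
  have hb : (-1 : ℤ) ∈ {u : ℤ | u + (4 * a + 1) ∈ Y} := by
    change (-1 : ℤ) + (4 * a + 1) ∈ Y; convert hy₁ using 1; ring
  have pat := pattern_neg (U := fun u => u + (4 * a + 1) ∈ X) (K := 4 * a)
    (fun u hu => by have := hXp _ hu; omega)
    (fun h => by have := T.mid_right h hy₁ hy₁; omega)
    (fun m hm1 hm2 => by
      have := T'.mem_or_mem_iff_of_base (v := 1) (w := -m) hb (fun y hy => by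
        rcases hY _ hy with h | h
        · left; omega
        · right
          refine ⟨by omega, fun x hx => ?_⟩
          have := T'.mem_left hx; omega) (by omega) (by omega) (by omega) (by omega) (by omega)
      rw [show -(2 * m) = 2 * -m by ring]
      exact this)
  obtain ⟨k, hk⟩ : ∃ k : ℕ, (k : ℤ) = 4 * a := ⟨(4 * a).toNat, by omega⟩
  obtain ⟨n, hn⟩ := exists_four_pow_of_clog (K := k) (by omega) (fun m hm1 hm2 => by
    rw [← pat m (by omega) (by omega)]
    have := (T'.mem_or_mem_iff_of_base (v := 1) (w := -m) hb (fun y hy => by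
        rcases hY _ hy with h | h
        · left; omega
        · right
          refine ⟨by omega, fun x hx => ?_⟩
          have := T'.mem_left hx; omega) (by omega) (by omega) (by omega) (by omega) (by omega))
    refine this.2 fun h => ?_
    have := T'.mem_left h; omega)
  obtain ⟨n, rfl⟩ : ∃ i, n = i + 1 := ⟨n - 1, by
    rcases n with _ | n
    · simp at hn; omega
    · rfl⟩
  have hna : a = 4 ^ n := by
    have : (k : ℤ) = 4 ^ (n + 1) := by exact_mod_cast hn
    rw [pow_succ] at this; omega
  subst hna
  exact ⟨n, rfl, hI, hY, pat⟩

theorem false_of_sixteen_twenty (T : Tiling X Y 1 1 N) (x1 : 1 ∈ X) (x7 : 7 ∈ X) (y4 : 4 ∈ Y)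
    (y16 : 16 ∈ Y) (y20 : 20 ∈ Y) : False := by
  obtain ⟨-, hX, hY⟩ := T.parities x1
  have hN := T.mem_right y20
  have x3 : 3 ∉ X := fun h => by have := T.mid_left x1 y4 h; omega
  have x5 : 5 ∉ X := fun h => by have := T.left_right h y4; omega
  have x9 : 9 ∉ X := fun h => by have := T.mid_left x1 y16 h; omega
  have x11 : 11 ∉ X := fun h => by have := T.mid_left x1 y20 h; omega
  have x13 : 13 ∉ X := fun h => by have := T.mid_left x7 y20 h; omega
  have x15 : 15 ∉ X := fun h => by have := T.left_right h y16; omega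
  have x17 : 17 ∉ X := fun h => by have := T.left_right h y16; omega
  have x21 : 21 ∉ X := fun h => by have := T.left_right h y20; omega
  have x25 : 25 ∉ X := fun h => by have := T.mid_right h y16 y20; omega
  have y2 : 2 ∉ Y := fun h => by have := T.left_right x1 h; omega
  have y6 : 6 ∉ Y := fun h => by have := T.mid_right x7 y4 h; omega
  have y10 : 10 ∉ Y := fun h => by have := T.mid_mid x1 h x7 y4; omega
  have y12 : 12 ∉ Y := fun h => by have := T.mid_right x7 y16 h; omega
  have y14 : 14 ∉ Y := fun h => by have := T.mid_right x7 y20 h; omega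
  have y22 : 22 ∉ Y := fun h => by have := T.mid_mid x1 h x7 y16; omega
  have y18 : 18 ∈ Y := by
    rcases T.cover 10 (by omega) (by omega) with h | h | h | h | ⟨x, hx, y, hy, e⟩
    · have := hX _ h; omega
    · exact absurd h x9
    · exact absurd h y10
    · have := hY _ h; omega
    · have b1 := T.mem_left hx
      have b2 := T.mem_right hy
      have b3 := hX _ hx
      obtain rfl : y = 19 - x := by omega
      have : x = 1 ∨ x = 3 ∨ x = 5 ∨ x = 7 ∨ x = 9 ∨ x = 11 ∨ x = 13 ∨ x = 15 ∨ x = 17 := by omega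
      rcases this with rfl | rfl | rfl | rfl | rfl | rfl | rfl | rfl | rfl
      · exact hy
      all_goals first | exact absurd hx ‹_› | exact absurd hy ‹_›
  have x19 : 19 ∉ X := fun h => by have := T.left_right h y18; omega
  have y28 : 28 ∉ Y := fun h => by have := T.mid_right x7 h y18; omega
  rcases T.cover 15 (by omega) (by omega) with h | h | h | h | ⟨x, hx, y, hy, e⟩
  · exact absurd h x15
  · have := hX _ h; omega
  · have := hY _ h; omega
  · exact absurd h y14
  · have b1 := T.mem_left hx
    have b2 := T.mem_right hy
    have b3 := hX _ hx
    obtain rfl : y = 29 - x := by omega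
    have : x = 1 ∨ x = 3 ∨ x = 5 ∨ x = 7 ∨ x = 9 ∨ x = 11 ∨ x = 13 ∨ x = 15 ∨ x = 17 ∨ x = 19 ∨
      x = 21 ∨ x = 23 ∨ x = 25 ∨ x = 27 := by omega
    rcases this with rfl | rfl | rfl | rfl | rfl | rfl | rfl | rfl | rfl | rfl | rfl | rfl | rfl | rfl
    all_goals first | exact absurd hx ‹_› | exact absurd hy ‹_›

end Tiling
end UlrichPartition

/-! ### Two elements after an initial run, for gap one -/

namespace UlrichPartition
namespace Tiling

variable {X Y Z W : Set ℤ} {d L R N : ℤ}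

set_option maxHeartbeats 2000000 in
/-- If `Y` has a second element, the position `(y₁ + y₂) / 2 + 1` is not reached by sums with `y₁` or `y₂`,
and a third element of `Y` reaching it would have sums that collide with earlier ones. The start
`4, 16, 20` is excluded separately by `false_of_sixteen_twenty`, which leaves only `4, 10`. -/
theorem four_mem_and_ten_mem (T : Tiling X Y 1 1 N) (h1 : 1 ∈ X) {y₁ y₂ : ℤ} (hy₁ : y₁ ∈ Y)
    (hmin : ∀ y ∈ Y, y₁ ≤ y) (hy₂ : y₂ ∈ Y) (hlt : y₁ < y₂) (hmin₂ : ∀ y ∈ Y, y = y₁ ∨ y₂ ≤ y) :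
    4 ∈ Y ∧ 10 ∈ Y := by
  obtain ⟨n, hn, hI, hgap, hneg⟩ := T.least_eq_four_pow h1 hy₁ hmin
  obtain ⟨-, hXp, hYp⟩ := T.parities h1
  obtain ⟨a, ha⟩ : ∃ a : ℕ, a = 4 ^ n := ⟨_, rfl⟩
  have ha' : (4 : ℤ) ^ n = a := by rw [ha]; push_cast; rfl
  rw [ha'] at hn hI hgap
  subst hn
  have ha1 : 1 ≤ a := by rw [ha]; exact Nat.one_le_pow _ _ (by norm_num)
  have ha4 : a = 1 ∨ 4 ≤ a := by
    rcases Nat.eq_zero_or_pos n with rfl | hpos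
    · left; simpa using ha
    · right; rw [ha]; calc 4 = 4 ^ 1 := by norm_num
        _ ≤ 4 ^ n := Nat.pow_le_pow_right (by norm_num) hpos
  have T' := T.translate (4 * a + 1)
  set U : ℤ → Prop := fun u => u + (4 * a + 1) ∈ X with hUdef
  have toU : ∀ {u}, U u → u ∈ {u : ℤ | u + (4 * a + 1) ∈ X} := fun h => h
  set Y' : Set ℤ := {u : ℤ | u + (4 * a + 1) ∈ Y} with hY'def
  have hb : (-1 : ℤ) ∈ Y' := by
    change (-1 : ℤ) + (4 * a + 1) ∈ Y; convert hy₁ using 1; ring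
  have heven : ∀ u, U u → u % 2 = 0 := fun u hu => by have := hXp _ hu; omega
  have hUrun : ∀ i : ℤ, 0 ≤ i → i < a → U (-4 * a + 2 * i) := fun i h0 h1 => by
    change -4 * (a : ℤ) + 2 * i + (4 * a + 1) ∈ X
    convert hI i h0 h1 using 1; ring
  have hlow : ∀ u, U u → -4 * a ≤ u := fun u hu => by have := T'.mem_left (toU hu); omega
  have h0 : ¬ U 0 := fun h => by have := T'.left_right (toU h) hb; omega
  have hm2 : ¬ U (-2) := fun h => by have := T'.mid_right (toU h) hb hb; omega
  have hm4 : U (-4) ↔ 4 ≤ 4 * a := by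
    refine ⟨fun _ => by omega, fun _ => ?_⟩
    have e : Nat.clog 2 4 = 2 := by simp [Nat.clog_of_two_le]
    rcases (hneg 4 (by norm_num) (by push_cast; omega)).2 (by rw [e]; exact even_two) with h | h
    · exact h
    · have := hXp _ h; omega
  have hU4 := hm4.2 (by omega)
  -- the second element, in the new coordinates
  have hev := hYp _ hy₂
  obtain ⟨v, hv⟩ : ∃ v : ℤ, y₂ - (4 * a + 1) = 2 * v + 4 * a - 1 :=
    ⟨(y₂ - (4 * a + 1) - 4 * a + 1) / 2, by omega⟩
  have hz : 2 * v + 4 * a - 1 ∈ Y' := by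
    change _ + _ ∈ Y; convert hy₂ using 1; omega
  have hv1 : 1 ≤ v := by
    have := hgap _ hy₂; omega
  lift v to ℕ using by omega
  have hz2 : ∀ z ∈ Y', z = -1 ∨ ∃ t : ℤ, 0 ≤ t ∧ z = 2 * v + 4 * a - 1 + 2 * t := fun z hz => by
    have e1 := hYp _ hz
    rcases hmin₂ _ hz with h | h
    · left; omega
    · right; exact ⟨(z - (2 * v + 4 * a - 1)) / 2, by omega, by omega⟩
  have hR := T'.mem_right hz
  have rule : ∀ w : ℤ, 1 ≤ w → w < v → ((U w ∨ U (w - 1)) ↔ ¬ U (2 * w)) := fun w hw1 hwv =>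
    T'.mem_or_mem_iff_of_base (v := v) hb (fun y hy => by
      rcases hz2 y hy with h | ⟨t, ht, rfl⟩
      · exact Or.inl h
      · refine Or.inr ⟨by omega, fun x hx => ?_⟩
        have := hlow x hx; omega) (by omega) (by omega) hwv (by omega) (by omega)
  have pat := pattern_pos heven h0 rule
  -- a position reached by a sum with the second element is reached in no other way
  have notP : ∀ w u : ℤ, U u → 2 * w = 2 * v + 4 * a + u → ¬ (U w ∨ U (w - 1)) := fun w u hu hw h => by
    rcases h with h | h
    · have := T'.mid_left (toU hu) hz (toU h); omega
    · have := T'.mid_left (toU hu) hz (toU h); omega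
  have notU : ∀ w u : ℤ, U u → 2 * w = 2 * v + 4 * a + u → ¬ U (2 * w) := fun w u hu hw h => by
    have := T'.mid_mid (toU hu) hz (toU h) hb (by omega); omega
  have notZ : ∀ t u u' : ℤ, 2 * v + 4 * a - 1 + 2 * t ∈ Y' → 1 ≤ t → U u → U u' →
      u ≠ 2 * t + u' := fun t u u' ht ht1 hu hu' h => by
    have := T'.mid_mid (toU hu) hz (toU hu') ht (by omega); omega
  have htr : 4 ≤ a → ∀ t : ℤ, 1 ≤ t → 2 * v + 4 * a - 1 + 2 * t ∈ Y' → 2 * a - 1 ≤ t := by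
    intro ha4 t ht htZ
    by_contra hlt
    rcases (by omega : t < a ∨ a ≤ t) with h | h
    · exact notZ t _ _ htZ ht (hUrun t (by omega) h) (hUrun 0 le_rfl (by omega)) (by ring)
    · exact notZ t _ _ htZ ht hU4 (hUrun (2 * a - 2 - t) (by omega) (by omega)) (by ring)
  obtain ⟨p, hp1, hp2⟩ : ∃ p, 4 ^ p ≤ v ∧ v < 4 * 4 ^ p :=
    ⟨Nat.log 4 v, Nat.pow_log_le_self 4 (by omega), by
      have := Nat.lt_pow_succ_log_self (b := 4) (by norm_num) v
      rwa [pow_succ, mul_comm] at this⟩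
  have hPv : ¬ (U v ∨ U (v - 1)) := notP v (-4 * a) (by simpa using hUrun 0 le_rfl (by omega)) (by ring)
  have hpv : v < 2 * 4 ^ p := by
    by_contra hge
    exact hPv ((pat v (by omega) (by omega)).2 ((odd_log_iff hp1 hp2).2 (by omega)))
  obtain ⟨q, hq⟩ : ∃ q : ℕ, q = 4 ^ p := ⟨_, rfl⟩
  have hlogq : ∀ w : ℕ, q ≤ w → w < 4 * q → (Odd (Nat.log 2 w) ↔ 2 * q ≤ w) := by
    rw [hq]; exact fun w => odd_log_iff
  rw [← hq] at hp1 hp2 hpv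
  rcases Nat.eq_zero_or_pos p with rfl | hp
  · -- the second element is `2 y₁ + 2`
    obtain rfl : v = 1 := by rw [pow_zero] at hq; omega
    rcases ha4 with rfl | ha4
    · refine ⟨by simpa using hy₁, ?_⟩
      convert hy₂ using 1; push_cast at *; omega
    exfalso
    have hnone : ∀ w, 1 ≤ w → w ≤ 2 * (a : ℤ) + 1 → ¬ U w := fun w hw1 hw2 h => by
      have e := heven w h
      refine notU (w / 2) _ (hUrun (w / 2 - 1) (by omega) (by omega)) (by push_cast; ring) ?_
      convert h using 1; omega
    rcases T'.cover (2 * a + 1) (by omega) (by omega) with h | h | h | h | ⟨u, hu, z, hz', e⟩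
    · exact hnone _ (by omega) (by omega) h
    · exact hnone _ (by omega) (by omega) h
    · rcases hz2 _ h with h' | ⟨t, ht, h'⟩ <;> omega
    · rcases hz2 _ h with h' | ⟨t, ht, h'⟩ <;> omega
    · rcases hz2 _ hz' with rfl | ⟨t, ht, rfl⟩
      · have := T'.left_right hu hz; omega
      obtain rfl : u = -2 * t := by omega
      have hlo := hlow _ hu
      have ht0 : 1 ≤ t := by
        by_contra hlt
        obtain rfl : t = 0 := by omega
        exact h0 (by simpa using hu)
      have htlo := htr ha4 t ht0 hz'
      rcases T'.cover (a + 1) (by omega) (by omega) with h | h | h | h | ⟨x, hx, y, hy, e'⟩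
      · exact hnone _ (by omega) (by omega) h
      · exact hnone _ (by omega) (by omega) h
      · rcases hz2 _ h with h' | ⟨t, ht, h'⟩ <;> omega
      · rcases hz2 _ h with h' | ⟨t, ht, h'⟩ <;> omega
      · have hxlo := hlow _ hx
        rcases hz2 _ hy with rfl | ⟨t', ht', rfl⟩
        · have := T'.mid_left (toU (hUrun (2 * a + 1 - t) (by omega) (by omega))) hz' hx
          push_cast at this; omega
        · by_cases ht0' : t' = 0
          · subst ht0'
            have := T'.mid_left (toU (hUrun 0 le_rfl (by omega))) hb hx
            push_cast at *; omega
          · have := htr ha4 t' (by omega) hy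
            push_cast at *; omega
  exfalso
  have hq4 : 4 ≤ q ∧ q % 4 = 0 := by
    obtain ⟨i, rfl⟩ : ∃ i, p = i + 1 := ⟨p - 1, by omega⟩
    have : 0 < 4 ^ i := by positivity
    rw [pow_succ] at hq; omega
  have hU2 : U 2 := by
    have e : Nat.log 2 2 = 1 := by decide
    rcases (pat 2 (by norm_num) (by push_cast; omega)).2 (by rw [e]; exact odd_one) with h | h
    · exact h
    · have := heven _ h; omega
  have hU8 : 5 ≤ v → U 8 := fun hv => by
    have e : Nat.log 2 8 = 3 := by decide
    rcases (pat 8 (by norm_num) (by push_cast; omega)).2 (by rw [e]; decide) with h | h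
    · exact h
    · have := heven _ h; omega
  have hU12 : 7 ≤ v → U 12 := fun hv => by
    have e : Nat.log 2 12 = 3 := by decide
    rcases (pat 12 (by norm_num) (by push_cast; omega)).2 (by rw [e]; decide) with h | h
    · exact h
    · have := heven _ h; omega
  -- `v + 2 a` is half the sum of the first two elements, shifted by one
  have hPg : ¬ (U (v + 2 * a) ∨ U (v + 2 * a - 1)) := by
    by_cases hvq : v = q
    · by_cases hlt : v + 2 * a < 2 * v
      · intro h
        have := (hlogq (v + 2 * a) (by omega) (by omega)).1
          ((pat (v + 2 * a) (by omega) (by push_cast; omega)).1 (by push_cast; exact h))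
        omega
      · rintro (h | h)
        · refine notU (v / 2 + a) _ (hUrun (a - v / 2) (by omega) (by omega)) (by omega) ?_
          convert h using 1; omega
        · have := heven _ h; omega
    · have hva : v + a ≤ 2 * q := by
        by_contra hlt
        refine notP (2 * q) _ (hUrun (2 * q - v) (by omega) (by omega)) (by ring) ?_
        have := (pat (2 * q) (by omega) (by push_cast; omega)).2
          ((hlogq _ (by omega) (by omega)).2 le_rfl)
        push_cast at this; exact this
      have haq : 4 * a ≤ q := by
        have : a < q := by omega
        rw [ha, hq] at this
        have hnp := (Nat.pow_lt_pow_iff_right (by norm_num : 1 < 4)).1 this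
        rw [ha, hq]
        calc 4 * 4 ^ n = 4 ^ (n + 1) := by ring
          _ ≤ 4 ^ p := Nat.pow_le_pow_right (by norm_num) hnp
      have hP1 : ¬ Odd (Nat.log 2 (v + 2 * a + 1)) := by
        rw [← pat (v + 2 * a + 1) (by omega) (by push_cast; omega)]
        exact notP _ 2 hU2 (by push_cast; ring)
      rw [hlogq _ (by omega) (by omega)] at hP1
      intro h
      have := (hlogq (v + 2 * a) (by omega) (by omega)).1
          ((pat (v + 2 * a) (by omega) (by push_cast; omega)).1 (by push_cast; exact h))
      omega
  rcases T'.cover (v + 2 * a) (by omega) (by omega) with h | h | h | h | ⟨u, hu, z, hz', e⟩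
  · exact hPg (Or.inl h)
  · exact hPg (Or.inr h)
  · rcases hz2 _ h with h' | ⟨t, ht, h'⟩ <;> omega
  · rcases hz2 _ h with h' | ⟨t, ht, h'⟩ <;> omega
  rcases hz2 _ hz' with rfl | ⟨t, ht, rfl⟩
  · have := T'.left_right hu hz; omega
  obtain rfl : u = -2 * t := by omega
  have hlo := hlow _ hu
  have ht0 : 2 ≤ t := by
    by_contra hlt
    rcases (by omega : t = 0 ∨ t = 1) with rfl | rfl
    · exact h0 (by simpa using hu)
    · exact hm2 (by simpa using hu)
  rcases ha4 with rfl | ha4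
  · obtain rfl : t = 2 := by omega
    by_cases hv7 : 7 ≤ v
    · exact notZ 2 12 8 hz' (by norm_num) (hU12 hv7) (hU8 (by omega)) (by norm_num)
    by_cases hv5 : 5 ≤ v
    · have h8 := hU8 hv5
      rcases (by omega : v = 5 ∨ v = 6) with rfl | rfl
      · exact notP 8 2 hU2 (by norm_num) (Or.inl h8)
      · exact notP 9 2 hU2 (by norm_num) (Or.inr h8)
    obtain rfl : v = 4 := by omega
    exact T.false_of_sixteen_twenty h1 hU2 hy₁ hz hz'
  · have := htr ha4 t (by omega) hz'
    exact notZ t 2 _ hz' (by omega) hU2 (hUrun (2 * a + 1 - t) (by omega) (by omega)) (by ring)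

end Tiling
end UlrichPartition

/-! ### Classification of the tilings with gap one -/

namespace UlrichPartition

/-- Numbers in `(M / 2, M]` with odd logarithm only: `M + 1` is a power of `4`. -/
theorem exists_four_pow_of_log {M : ℕ} (hM : M = 0 ∨ M % 2 = 1)
    (h : ∀ w, M < 2 * w → w ≤ M → Odd (Nat.log 2 w)) : ∃ m, M + 1 = 4 ^ m := by
  rcases hM with rfl | hM
  · exact ⟨0, rfl⟩
  have hle := Nat.pow_log_le_self 2 (x := M) (by omega)
  have hlt := Nat.lt_pow_succ_log_self (b := 2) (by norm_num) M
  obtain ⟨i, hi⟩ := h M (by omega) le_rfl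
  rw [hi] at hle
  replace hlt : M < 2 ^ (2 * i + 1 + 1) := by rwa [hi] at hlt
  refine ⟨i + 1, ?_⟩
  have e : (4 : ℕ) ^ (i + 1) = 2 ^ (2 * i + 1 + 1) := by
    rw [show 2 * i + 1 + 1 = 2 * (i + 1) by ring, pow_mul]; norm_num
  rw [e]
  by_contra hne
  obtain ⟨c, hc⟩ : ∃ c : ℕ, c = 2 ^ (2 * i) := ⟨_, rfl⟩
  have hpos : 0 < c := by rw [hc]; positivity
  have hp' : (2 : ℕ) ^ (2 * i + 1) = 2 * c := by rw [hc]; ring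
  have hp : (2 : ℕ) ^ (2 * i + 1 + 1) = 4 * c := by rw [hc]; ring
  rw [hp] at hne hlt
  rw [hp'] at hle
  have := h (2 * c - 1) (by omega) (by omega)
  rw [(Nat.log_eq_iff (m := 2 * i) (Or.inr ⟨by norm_num, by omega⟩)).2
    ⟨by rw [← hc]; omega, by rw [hp']; omega⟩] at this
  exact Nat.not_odd_iff_even.2 (even_two_mul i) this

/-- The even numbers of the intervals `[2 * 4 ^ i, 4 ^ (i + 1))` with `i < m`. -/
def upperOffsets (m : ℕ) : Finset ℕ :=
  (Finset.Ico 1 (4 ^ m)).filter fun u => Even u ∧ Odd (Nat.log 2 u)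

/-- The even numbers of the intervals `(2 * 4 ^ i, 4 ^ (i + 1)]` with `i < n`. -/
def lowerOffsets (n : ℕ) : Finset ℕ :=
  (Finset.Icc 1 (4 ^ n)).filter fun u => Even u ∧ Even (Nat.clog 2 u)

/-- The set which, together with the singleton `{4 ^ n}` and `d = 1`, tiles `[1, 4 ^ n + 4 ^ m]`. Its
elements are given by their distances to `4 ^ n + 1` on either side. -/
def pattern (n m : ℕ) : Finset ℤ :=
  (upperOffsets m).image (fun u : ℕ => (4 ^ n + 1 + u : ℤ)) ∪
    (lowerOffsets n).image (fun u : ℕ => (4 ^ n + 1 - u : ℤ))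

theorem mem_pattern {n m : ℕ} {x : ℤ} : x ∈ pattern n m ↔
    (∃ u : ℕ, x = 4 ^ n + 1 + u ∧ 1 ≤ u ∧ u < 4 ^ m ∧ u % 2 = 0 ∧ Odd (Nat.log 2 u)) ∨
    ∃ u : ℕ, x = 4 ^ n + 1 - u ∧ 1 ≤ u ∧ u ≤ 4 ^ n ∧ u % 2 = 0 ∧ Even (Nat.clog 2 u) := by
  simp only [pattern, upperOffsets, lowerOffsets, Finset.mem_union, Finset.mem_image, Finset.mem_filter,
    Finset.mem_Ico, Finset.mem_Icc, Nat.even_iff (n := _)]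
  constructor
  · rintro (⟨u, h, rfl⟩ | ⟨u, h, rfl⟩)
    · exact Or.inl ⟨u, rfl, by tauto⟩
    · exact Or.inr ⟨u, rfl, by tauto⟩
  · rintro (⟨u, rfl, h⟩ | ⟨u, rfl, h⟩)
    · exact Or.inl ⟨u, by tauto, rfl⟩
    · exact Or.inr ⟨u, by tauto, rfl⟩

namespace Tiling

variable {X Y Z W : Set ℤ} {d L R N : ℤ}

/-- The second element `x₂` of `X` is one less than twice the place `v` where its sums start; as `x₂` and
`x₂ + 1` are not otherwise covered, `v` must be the first number with its even logarithm. -/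
theorem second_of_ten_mem (T : Tiling X Y 1 1 N) (h1 : 1 ∈ X) (h4 : 4 ∈ Y) (h10 : 10 ∈ Y) {x₂ : ℤ}
    (hx₂ : x₂ ∈ X) (hlt : 1 < x₂) (hmin : ∀ x ∈ X, x = 1 ∨ x₂ ≤ x) :
    ∃ p : ℕ, 2 ≤ p ∧ x₂ = 2 * 4 ^ p - 1 ∧ ∀ w : ℕ, 1 ≤ w → w < 2 * 4 ^ p → w % 2 = 0 →
      ((w : ℤ) + 2 ∈ Y ↔ Odd (Nat.log 2 w)) := by
  obtain ⟨-, hXp, hYp⟩ := T.parities h1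
  have T' := (T.translate 2).swap
  set U : ℤ → Prop := fun u => u + 2 ∈ Y with hUdef
  have toU : ∀ {u}, U u → u ∈ {u : ℤ | u + 2 ∈ Y} := fun h => h
  have hb : (-1 : ℤ) ∈ {u : ℤ | u + 2 ∈ X} := h1
  have heven : ∀ u, U u → u % 2 = 0 := fun u hu => by have := hYp _ hu; omega
  have hlow : ∀ u, U u → 2 ≤ u := fun u hu => by
    have := T.mem_right hu; have := hYp _ hu; have := T.left_right h1 hu; omega
  have h0 : ¬ U 0 := fun h => by have := hlow _ h; omega
  have hxo := hXp _ hx₂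
  obtain ⟨v, rfl⟩ : ∃ v : ℤ, x₂ = 2 * v - 1 := ⟨(x₂ + 1) / 2, by omega⟩
  have hv4 : 4 ≤ v := by
    by_contra hlt'
    rcases (by omega : v = 2 ∨ v = 3) with rfl | rfl
    · have := T.mid_left h1 h4 hx₂; omega
    · have := T.left_right hx₂ h4; omega
  lift v to ℕ using by omega
  have hR := T.mem_left hx₂
  have hz : 2 * (v : ℤ) - 3 ∈ {u : ℤ | u + 2 ∈ X} := by
    change _ + _ ∈ X; convert hx₂ using 1; ring
  have rule : ∀ w : ℤ, 1 ≤ w → w < v → ((U w ∨ U (w - 1)) ↔ ¬ U (2 * w)) := fun w hw1 hwv =>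
    T'.mem_or_mem_iff_of_base (v := v) hb (fun z hz => by
      rcases hmin _ hz with h | h
      · left; omega
      · refine Or.inr ⟨by omega, fun x hx => ?_⟩
        have := hlow x hx; omega) (by omega) (by omega) hwv (by omega) (by omega)
  have pat := pattern_pos heven h0 rule
  obtain ⟨p, hp1, hp2⟩ : ∃ p, 4 ^ p ≤ v ∧ v < 4 * 4 ^ p :=
    ⟨Nat.log 4 v, Nat.pow_log_le_self 4 (by omega), by
      have := Nat.lt_pow_succ_log_self (b := 4) (by norm_num) v
      rwa [pow_succ, mul_comm] at this⟩
  have hU2 : U 2 := h4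
  have hPv : ¬ (U v ∨ U (v - 1)) := fun h => by
    rcases h with h | h
    · have := T'.mid_left (toU hU2) hz (toU h); omega
    · have := T'.mid_left (toU hU2) hz (toU h); omega
  have hP2 : ¬ (U (2 * v - 2) ∨ U (2 * v - 2 - 1)) := fun h => by
    rcases h with h | h
    · have := T'.left_right (toU h) hz; omega
    · have := T'.left_right (toU h) hz; omega
  have hpv : v < 2 * 4 ^ p := by
    by_contra hge
    exact hPv ((pat v (by omega) (by omega)).2 ((odd_log_iff hp1 hp2).2 (by omega)))
  have hvp : v = 4 ^ p := by
    by_contra hne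
    have := (pat (2 * v - 2) (by omega) (by omega)).2
      ((odd_log_iff (p := p) (by omega) (by omega)).2 (by omega))
    exact hP2 (by rwa [show ((2 * v - 2 : ℕ) : ℤ) = 2 * v - 2 by omega] at this)
  have hp : 2 ≤ p := by
    by_contra hlt
    rcases (by omega : p = 0 ∨ p = 1) with rfl | rfl
    · simp at hvp; omega
    · obtain rfl : v = 4 := by simpa using hvp
      have := T.mid_mid hx₂ h4 h1 h10; norm_num at this
  refine ⟨p, hp, by rw [hvp]; push_cast; ring, fun w hw1 hw2 hwe => ?_⟩
  rw [← pat w hw1 (by rw [hvp]; exact_mod_cast hw2)]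
  refine ⟨Or.inl, fun h => h.resolve_right fun h' => ?_⟩
  have := heven _ h'; omega

/-- With `x = 2 * v - 1` the smaller of the second elements at the two ends, `v ∈ Y` and `N - v ∈ Y`, and
`(N - 1) + v = x + (N - v)` are two equal sums. -/
theorem false_of_ten_mem_of_le (T : Tiling X Y 1 1 N) (h1 : 1 ∈ X) (h4 : 4 ∈ Y) (h10 : 10 ∈ Y)
    (h1' : 1 + N - 1 - 1 ∈ X) (h4' : 1 + N - 1 - 4 ∈ Y) (h10' : 1 + N - 1 - 10 ∈ Y) {x z : ℤ}
    (hx : x ∈ X) (hlt : 1 < x) (hmin : ∀ u ∈ X, u = 1 ∨ x ≤ u)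
    (hz : 1 + N - 1 - z ∈ X) (hlt' : 1 < z) (hmin' : ∀ u, 1 + N - 1 - u ∈ X → u = 1 ∨ z ≤ u)
    (hle : x ≤ z) : False := by
  obtain ⟨p, hp, rfl, hpat⟩ := T.second_of_ten_mem h1 h4 h10 hx hlt hmin
  obtain ⟨p', hp', rfl, hpat'⟩ := T.reflect.second_of_ten_mem h1' h4' h10' hz hlt' hmin'
  have hpp : (4 : ℕ) ^ p ≤ 4 ^ p' := by
    have : (4 : ℤ) ^ p ≤ 4 ^ p' := by omega
    exact_mod_cast this
  obtain ⟨i, rfl⟩ : ∃ i, p = i + 1 := ⟨p - 1, by omega⟩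
  have hi : 4 ≤ 4 ^ i := by
    calc 4 = 4 ^ 1 := by norm_num
      _ ≤ 4 ^ i := Nat.pow_le_pow_right (by norm_num) (by omega)
  have hs : (4 : ℕ) ^ (i + 1) = 4 * 4 ^ i := by ring
  have hsz : (4 : ℤ) ^ (i + 1) = (4 ^ (i + 1) : ℕ) := by push_cast; rfl
  have hodd : Odd (Nat.log 2 (4 ^ (i + 1) - 2)) := (odd_log_iff (p := i) (by omega) (by omega)).2
    (by omega)
  have a := (hpat (4 ^ (i + 1) - 2) (by omega) (by omega) (by omega)).2 hodd
  have b := (hpat' (4 ^ (i + 1) - 2) (by omega) (by omega) (by omega)).2 hodd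
  change 1 + N - 1 - _ ∈ Y at b
  have hN := T.mid_mid h1' a hx b (by omega)
  have c := hpat (2 * 4 ^ (i + 1) - 6) (by omega) (by omega) (by omega)
  rw [odd_log_iff (p := i + 1) (by omega) (by omega)] at c
  have := c.1 (by convert h4' using 1; omega)
  omega

theorem false_of_ten_mem (T : Tiling X Y 1 1 N) (h1 : 1 ∈ X) (h4 : 4 ∈ Y) (h10 : 10 ∈ Y)
    (h1' : 1 + N - 1 - 1 ∈ X) (h4' : 1 + N - 1 - 4 ∈ Y) (h10' : 1 + N - 1 - 10 ∈ Y) : False := by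
  have hN := T.mem_right h10
  obtain ⟨z, hz, hez, hmin⟩ := exists_second (fun x hx => (T.mem_left hx).1) h1' (by omega)
    (fun x hx => (T.mem_left hx).1)
  obtain ⟨z', hz', hez', hmin'⟩ := exists_second (fun x hx => (T.reflect.mem_left hx).1)
    (b := 1 + N - 1 - 1) (by
      change 1 + N - 1 - (1 + N - 1 - 1) ∈ X
      convert h1 using 1; ring) (by omega) (fun x hx => (T.reflect.mem_left hx).1)
  have rr : ∀ (A : Set ℤ) {u : ℤ}, u ∈ A → 1 + N - 1 - (1 + N - 1 - u) ∈ A := fun A u hu => by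
    convert hu using 1; ring
  rcases le_total z z' with h | h
  · exact T.false_of_ten_mem_of_le h1 h4 h10 h1' h4' h10' hz hez hmin hz' hez' hmin' h
  · refine T.reflect.false_of_ten_mem_of_le h1' h4' h10' (rr X h1) (rr Y h4) (rr Y h10) hz' hez' hmin'
      (rr X hz) hez (fun u hu => hmin u ?_) h
    change 1 + N - 1 - (1 + N - 1 - u) ∈ X at hu
    convert hu using 1; ring

/-- The recursion holds on the whole interval, and doubles of its largest positions leave it; this
determines the right end. -/
theorem eq_pattern_of_singleton (T : Tiling X Y 1 1 N) {n : ℕ} (hY : Y = {(4 : ℤ) ^ n}) (hX : ∀ x ∈ X, (x - (4 ^ n + 1)) % 2 = 0)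
    (hneg : ∀ m : ℕ, 2 ≤ m → m ≤ 4 ^ n →
        ((-(m : ℤ) + (4 ^ n + 1) ∈ X ∨ -(m : ℤ) - 1 + (4 ^ n + 1) ∈ X) ↔ Even (Nat.clog 2 m))) :
    ∃ m : ℕ, N = 4 ^ n + 4 ^ m ∧ X = pattern n m := by
  have hy : (4 : ℤ) ^ n ∈ Y := by rw [hY]; rfl
  have hyN := T.mem_right hy
  have T' := T.translate (4 ^ n + 1)
  set U : ℤ → Prop := fun u => u + (4 ^ n + 1) ∈ X with hUdef
  have toU : ∀ {u}, U u → u ∈ {u : ℤ | u + (4 ^ n + 1) ∈ X} := fun h => h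
  have hb : (-1 : ℤ) ∈ {u : ℤ | u + (4 ^ n + 1) ∈ Y} := by
    change (-1 : ℤ) + (4 ^ n + 1) ∈ Y; convert hy using 1; ring
  have heven : ∀ u, U u → u % 2 = 0 := fun u hu => by have := hX _ hu; omega
  have h0 : ¬ U 0 := fun h => by have := T'.left_right (toU h) hb; omega
  obtain ⟨M, hM⟩ : ∃ M : ℕ, N = 4 ^ n + 1 + M := ⟨(N - (4 ^ n + 1)).toNat, by omega⟩
  have rule : ∀ w : ℤ, 1 ≤ w → w < (M + 1 : ℤ) → ((U w ∨ U (w - 1)) ↔ ¬ U (2 * w)) := fun w hw1 hwv =>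
    T'.mem_or_mem_iff_of_base (v := M + 1) hb (fun z hz => by
      left
      change z + (4 ^ n + 1) ∈ Y at hz
      rw [hY, Set.mem_singleton_iff] at hz
      omega) (by omega) (by omega) hwv (by omega) (by omega)
  have pat := pattern_pos heven h0 rule
  have hlt : ∀ u, U u → u < M := fun u hu => by have := T'.mem_left (toU hu); omega
  have hlow : ∀ u, U u → -4 ^ n ≤ u := fun u hu => by have := T'.mem_left (toU hu); omega
  obtain ⟨m, hm⟩ := exists_four_pow_of_log (M := M) (by
    by_contra hne
    have := (rule M (by omega) (by omega)).2 (fun h => by have := hlt _ h; omega)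
    rcases this with h | h
    · have := hlt _ h; omega
    · have := heven _ h; omega) (fun w hw1 hw2 => by
    rw [← pat w (by omega) (by omega)]
    exact (rule w (by omega) (by omega)).2 (fun h => by have := hlt _ h; omega))
  have hmz : (M : ℤ) + 1 = 4 ^ m := by exact_mod_cast hm
  have hnz : (4 : ℤ) ^ n = (4 ^ n : ℕ) := by push_cast; rfl
  refine ⟨m, by omega, Set.ext fun x => ?_⟩
  rw [Finset.mem_coe, mem_pattern]
  constructor
  · intro hx
    have hxU : U (x - (4 ^ n + 1)) := by change _ + _ ∈ X; convert hx using 1; ring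
    have e := heven _ hxU
    have l := hlt _ hxU
    have l' := hlow _ hxU
    rcases lt_trichotomy (x - (4 ^ n + 1)) 0 with h | h | h
    · obtain ⟨u, hu⟩ : ∃ u : ℕ, x - (4 ^ n + 1) = -u := ⟨(-(x - (4 ^ n + 1))).toNat, by omega⟩
      rw [hu] at hxU
      refine Or.inr ⟨u, by omega, by omega, by omega, by omega, ?_⟩
      exact (hneg u (by omega) (by omega)).1 (Or.inl hxU)
    · rw [h] at hxU; exact absurd hxU h0
    · obtain ⟨u, hu⟩ : ∃ u : ℕ, x - (4 ^ n + 1) = u := ⟨(x - (4 ^ n + 1)).toNat, by omega⟩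
      rw [hu] at hxU
      refine Or.inl ⟨u, by omega, by omega, by omega, by omega, ?_⟩
      exact (pat u (by omega) (by omega)).1 (Or.inl hxU)
  · rintro (⟨u, rfl, hu1, hu2, hue, hu⟩ | ⟨u, rfl, hu1, hu2, hue, hu⟩)
    · rcases (pat u (by omega) (by omega)).2 hu with h | h
      · change _ + _ ∈ X at h
        convert h using 1; ring
      · have := heven _ h; omega
    · rcases (hneg u (by omega) (by omega)).2 hu with h | h
      · convert h using 1; ring
      · have := hX _ h; omega

theorem eq_of_gap_one (T : Tiling X Y 1 1 N) (h1 : 1 ∈ X) :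
    ∃ n m : ℕ, N = 4 ^ n + 4 ^ m ∧
      ((Y = {(4 : ℤ) ^ n} ∧ X = pattern n m) ∨ (X = {(4 : ℤ) ^ n} ∧ Y = pattern n m)) := by
  obtain ⟨-, hXp, hYp⟩ := T.parities h1
  obtain ⟨y₁, hy₁, hmin⟩ := Int.exists_least_of_bdd (P := fun y => y ∈ Y)
    ⟨1, fun y hy => (T.mem_right hy).1⟩ T.nonempty_right
  by_cases hYs : ∀ y ∈ Y, y = y₁
  · obtain ⟨n, hn, hI, hgap, hneg⟩ := T.least_eq_four_pow h1 hy₁ hmin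
    have hn' : y₁ = 4 ^ (n + 1) := by rw [hn]; ring
    have hYe : Y = {(4 : ℤ) ^ (n + 1)} := by
      rw [← hn']; exact Set.eq_singleton_iff_unique_mem.2 ⟨hy₁, hYs⟩
    obtain ⟨m, hm, hX⟩ := T.eq_pattern_of_singleton hYe (fun x hx => by
        have := hXp x hx; rw [← hn']; omega) (fun m hm1 hm2 => by
        rw [← hn']
        exact hneg m hm1 (by rw [hn']; exact_mod_cast hm2))
    exact ⟨n + 1, m, hm, Or.inl ⟨hYe, hX⟩⟩
  push Not at hYs
  obtain ⟨b, hb, hbne⟩ := hYs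
  obtain ⟨y₂, hy₂, hlt, hmin₂⟩ := exists_second (fun x hx => (T.mem_right hx).1) hb hbne hmin
  obtain ⟨h4, h10⟩ := T.four_mem_and_ten_mem h1 hy₁ hmin hy₂ hlt hmin₂
  have hN := T.mem_right h10
  by_cases hXs : ∀ x ∈ X, x = 1
  · have hXe : X = {(4 : ℤ) ^ 0} := by
      rw [pow_zero]; exact Set.eq_singleton_iff_unique_mem.2 ⟨h1, hXs⟩
    obtain ⟨m, hm, hX⟩ := T.swap.eq_pattern_of_singleton hXe (fun x hx => by
        have := hYp x hx; rw [pow_zero]; omega) (fun m hm1 hm2 => by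
        rw [pow_zero] at hm2; omega)
    exact ⟨0, m, hm, Or.inr ⟨hXe, hX⟩⟩
  exfalso
  push Not at hXs
  obtain ⟨c, hc, hcne⟩ := hXs
  have rr : ∀ (A : Set ℤ) {u : ℤ}, u ∈ A → 1 + N - 1 - u ∈ {u : ℤ | 1 + N - 1 - u ∈ A} :=
    fun A u hu => by
      change 1 + N - 1 - (1 + N - 1 - u) ∈ A
      convert hu using 1; ring
  rcases T.reflect.first_mem with hr | hr
  · obtain ⟨z₁, hz₁, hzmin⟩ := Int.exists_least_of_bdd (P := fun y => y ∈ {u : ℤ | 1 + N - 1 - u ∈ Y})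
      ⟨1, fun y hy => (T.reflect.mem_right hy).1⟩ T.reflect.nonempty_right
    obtain ⟨b', hb', hbne'⟩ : ∃ b' ∈ {u : ℤ | 1 + N - 1 - u ∈ Y}, b' ≠ z₁ := by
      by_contra hno
      push Not at hno
      have := hno _ (rr Y h4)
      have := hno _ (rr Y h10)
      omega
    obtain ⟨z₂, hz₂, hzlt, hzmin₂⟩ := exists_second (fun x hx => (T.reflect.mem_right hx).1) hb' hbne' hzmin
    obtain ⟨r4, r10⟩ := T.reflect.four_mem_and_ten_mem hr hz₁ hzmin hz₂ hzlt hzmin₂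
    exact T.false_of_ten_mem h1 h4 h10 hr r4 r10
  · obtain ⟨z₁, hz₁, hzmin⟩ := Int.exists_least_of_bdd (P := fun y => y ∈ {u : ℤ | 1 + N - 1 - u ∈ X})
      ⟨1, fun y hy => (T.reflect.mem_left hy).1⟩ T.reflect.nonempty_left
    obtain ⟨b', hb', hbne'⟩ : ∃ b' ∈ {u : ℤ | 1 + N - 1 - u ∈ X}, b' ≠ z₁ := by
      by_contra hno
      push Not at hno
      have := hno _ (rr X h1)
      have := hno _ (rr X hc)
      omega
    obtain ⟨z₂, hz₂, hzlt, hzmin₂⟩ := exists_second (fun x hx => (T.reflect.mem_left hx).1) hb' hbne' hzmin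
    obtain ⟨r4, r10⟩ := T.reflect.swap.four_mem_and_ten_mem hr hz₁ hzmin hz₂ hzlt hzmin₂
    change 1 + N - 1 - 1 ∈ Y at hr
    change 1 + N - 1 - 4 ∈ X at r4
    have := T.mid_mid h1 hr r4 h4 (by ring)
    omega

end Tiling
end UlrichPartition

/-! ### Ulrich partitions and tilings -/

namespace UlrichPartition

/-- The pairs of entries of `P` in different blocks, the block with the smaller index first. -/
def pairs {r : ℕ} (P : Blocks r) : Finset (Σ _ : Fin (r + 1), Σ _ : Fin (r + 1), ℤ × ℤ) :=
  Finset.univ.sigma fun i => (Finset.Ioi i).sigma fun j => P i ×ˢ P j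

theorem mem_pairs {r : ℕ} {P : Blocks r} {i j : Fin (r + 1)} {x y : ℤ} :
    ⟨i, j, x, y⟩ ∈ pairs P ↔ i < j ∧ x ∈ P i ∧ y ∈ P j := by
  simp [pairs]

theorem card_pairs {r : ℕ} (P : Blocks r) : (pairs P).card = dim P := by
  simp [pairs, dim, Finset.card_sigma, Finset.card_product]

/-- In an Ulrich partition every pair of entries of different blocks meets at a time in `[1, dim P]`, and
no other pair meets at that time: each such time has a pair, a pair meets at most once, and there are
`dim P` pairs. -/
theorem IsUlrich.exists_meet {r : ℕ} {P : Blocks r} (h : IsUlrich P) :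
    ∀ p ∈ pairs P, ∃ t : ℕ, 1 ≤ t ∧ t ≤ dim P ∧
      p.2.2.1 - p.2.2.2 = (t : ℤ) * ((p.2.1.val : ℤ) - p.1.val) ∧
      ∀ q ∈ pairs P, q.2.2.1 - q.2.2.2 = (t : ℤ) * ((q.2.1.val : ℤ) - q.1.val) → q = p := by
  have hex : ∀ t : ℕ, t ∈ Finset.Icc 1 (dim P) → ∃ p ∈ pairs P,
      p.2.2.1 - p.2.2.2 = (t : ℤ) * ((p.2.1.val : ℤ) - p.1.val) := by
    intro t ht
    rw [Finset.mem_Icc] at ht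
    obtain ⟨i, j, x, hx, y, hy, hne, e⟩ := h.2 t ht.1 ht.2
    simp only [position] at e
    rcases lt_trichotomy i j with hij | rfl | hij
    · exact ⟨⟨i, j, x, y⟩, mem_pairs.2 ⟨hij, hx, hy⟩, by simp only; linarith⟩
    · exact absurd (by rw [show x = y by linarith]) hne
    · exact ⟨⟨j, i, y, x⟩, mem_pairs.2 ⟨hij, hy, hx⟩, by simp only; linarith⟩
  choose! f hf hft using hex
  have hinj : Set.InjOn f (Finset.Icc 1 (dim P)) := by
    intro t ht t' ht' e
    have e1 := hft t ht
    have e2 := hft t' ht'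
    rw [← e] at e2
    have hlt : (f t).1 < (f t).2.1 := (mem_pairs.1 (hf t ht)).1
    have hne : ((f t).2.1.val : ℤ) - (f t).1.val ≠ 0 := by
      rw [Fin.lt_def] at hlt; omega
    have := mul_right_cancel₀ hne (e1.symm.trans e2)
    exact_mod_cast this
  have hsurj := Finset.surjOn_of_injOn_of_card_le f (fun t ht => hf t ht) hinj
    (by rw [card_pairs]; simp)
  have hall : ∀ p ∈ pairs P, ∃ t ∈ Finset.Icc 1 (dim P), f t = p := fun p hp => hsurj hp
  intro p hp
  obtain ⟨t, ht, rfl⟩ := hall p hp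
  refine ⟨t, (Finset.mem_Icc.1 ht).1, (Finset.mem_Icc.1 ht).2, hft t ht, fun q hq e => ?_⟩
  obtain ⟨t', ht', rfl⟩ := hall q hq
  have hlt : (f t').1 < (f t').2.1 := (mem_pairs.1 hq).1
  have hne : ((f t').2.1.val : ℤ) - (f t').1.val ≠ 0 := by
    rw [Fin.lt_def] at hlt; omega
  have := mul_right_cancel₀ hne (e.symm.trans (hft t' ht'))
  rw [show t = t' by exact_mod_cast this]

theorem dim_two (P : Blocks 2) :
    dim P = (P 0).card * (P 1).card + (P 0).card * (P 2).card + (P 1).card * (P 2).card := by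
  have h0 : Finset.Ioi (0 : Fin 3) = {1, 2} := by decide
  have h1 : Finset.Ioi (1 : Fin 3) = {2} := by decide
  have h2 : Finset.Ioi (2 : Fin 3) = ∅ := by decide
  simp [dim, Fin.sum_univ_three, h0, h1, h2]

theorem tiling_of_isUlrich {P : Blocks 2} (h : IsUlrich P) {b d : ℤ} (hd : 1 ≤ d)
    (hB : P 1 = {b, b + d}) :
    Tiling {x | x + (b + d) ∈ P 0} {y | b - y ∈ P 2} d 1 (dim P) := by
  have hb : b ∈ P 1 := by simp [hB]
  have hbd : b + d ∈ P 1 := by simp [hB]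
  have hB' : ∀ β ∈ P 1, β = b ∨ β = b + d := fun β hβ => by simpa [hB] using hβ
  have ab : ∀ x ∈ P 0, ∀ β ∈ P 1, 1 ≤ x - β ∧ x - β ≤ dim P := fun x hx β hβ => by
    obtain ⟨t, h1, h2, e, -⟩ := h.exists_meet ⟨0, 1, x, β⟩ (mem_pairs.2 ⟨by decide, hx, hβ⟩)
    simp at e; omega
  have bc : ∀ β ∈ P 1, ∀ y ∈ P 2, 1 ≤ β - y ∧ β - y ≤ dim P := fun x hx β hβ => by
    obtain ⟨t, h1, h2, e, -⟩ := h.exists_meet ⟨1, 2, x, β⟩ (mem_pairs.2 ⟨by decide, hx, hβ⟩)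
    simp at e; omega
  have ac : ∀ x ∈ P 0, ∀ y ∈ P 2, (x - y) % 2 = 0 := fun x hx β hβ => by
    obtain ⟨t, h1, h2, e, -⟩ := h.exists_meet ⟨0, 2, x, β⟩ (mem_pairs.2 ⟨by decide, hx, hβ⟩)
    simp at e; omega
  have ab_ab : ∀ x ∈ P 0, ∀ β ∈ P 1, ∀ x' ∈ P 0, ∀ β' ∈ P 1, x - β = x' - β' → β = β' :=
    fun x hx β hβ x' hx' β' hβ' e' => by
    obtain ⟨t, h1, h2, e, hu⟩ := h.exists_meet ⟨0, 1, x, β⟩ (mem_pairs.2 ⟨by decide, hx, hβ⟩)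
    have := hu ⟨0, 1, x', β'⟩ (mem_pairs.2 ⟨by decide, hx', hβ'⟩) (by simp at e ⊢; omega)
    simp at this; exact this.2.symm
  have bc_bc : ∀ β ∈ P 1, ∀ y ∈ P 2, ∀ β' ∈ P 1, ∀ y' ∈ P 2, β - y = β' - y' → β = β' :=
    fun x hx β hβ x' hx' β' hβ' e' => by
    obtain ⟨t, h1, h2, e, hu⟩ := h.exists_meet ⟨1, 2, x, β⟩ (mem_pairs.2 ⟨by decide, hx, hβ⟩)
    have := hu ⟨1, 2, x', β'⟩ (mem_pairs.2 ⟨by decide, hx', hβ'⟩) (by simp at e ⊢; omega)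
    simp at this; exact this.1.symm
  have ac_ac : ∀ x ∈ P 0, ∀ y ∈ P 2, ∀ x' ∈ P 0, ∀ y' ∈ P 2, x - y = x' - y' → x = x' :=
    fun x hx β hβ x' hx' β' hβ' e' => by
    obtain ⟨t, h1, h2, e, hu⟩ := h.exists_meet ⟨0, 2, x, β⟩ (mem_pairs.2 ⟨by decide, hx, hβ⟩)
    have := hu ⟨0, 2, x', β'⟩ (mem_pairs.2 ⟨by decide, hx', hβ'⟩) (by simp at e ⊢; omega)
    simp at this; exact this.1.symm
  have ab_bc : ∀ x ∈ P 0, ∀ β ∈ P 1, ∀ β' ∈ P 1, ∀ y ∈ P 2, x - β ≠ β' - y :=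
    fun x hx β hβ x' hx' β' hβ' e' => by
    obtain ⟨t, h1, h2, e, hu⟩ := h.exists_meet ⟨0, 1, x, β⟩ (mem_pairs.2 ⟨by decide, hx, hβ⟩)
    have := hu ⟨1, 2, x', β'⟩ (mem_pairs.2 ⟨by decide, hx', hβ'⟩) (by simp at e ⊢; omega)
    simp at this
  have ab_ac : ∀ x ∈ P 0, ∀ β ∈ P 1, ∀ x' ∈ P 0, ∀ y ∈ P 2, 2 * (x - β) ≠ x' - y :=
    fun x hx β hβ x' hx' β' hβ' e' => by
    obtain ⟨t, h1, h2, e, hu⟩ := h.exists_meet ⟨0, 1, x, β⟩ (mem_pairs.2 ⟨by decide, hx, hβ⟩)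
    have := hu ⟨0, 2, x', β'⟩ (mem_pairs.2 ⟨by decide, hx', hβ'⟩) (by simp at e ⊢; omega)
    simp at this
  have bc_ac : ∀ β ∈ P 1, ∀ y ∈ P 2, ∀ x' ∈ P 0, ∀ y' ∈ P 2, 2 * (β - y) ≠ x' - y' :=
    fun x hx β hβ x' hx' β' hβ' e' => by
    obtain ⟨t, h1, h2, e, hu⟩ := h.exists_meet ⟨1, 2, x, β⟩ (mem_pairs.2 ⟨by decide, hx, hβ⟩)
    have := hu ⟨0, 2, x', β'⟩ (mem_pairs.2 ⟨by decide, hx', hβ'⟩) (by simp at e ⊢; omega)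
    simp at this
  have hne := h.1.1
  constructor
  · obtain ⟨x, hx⟩ := hne 0; exact ⟨x - (b + d), by simpa using hx⟩
  · obtain ⟨x, hx⟩ := hne 2; exact ⟨b - x, by simpa using hx⟩
  · exact hd
  · intro x hx
    have := ab _ hx _ hb; have := ab _ hx _ hbd; omega
  · intro x hx
    have := bc _ hb _ hx; have := bc _ hbd _ hx; omega
  · intro x y hx hy
    have := ac _ hx _ hy; omega
  · intro n h1 h2
    lift n to ℕ using by omega
    obtain ⟨i, j, x, hx, y, hy, hxy, e⟩ := h.2 n (by omega) (by omega)
    have hAB : ∀ x ∈ P 0, ∀ β ∈ P 1, x - n * 2 = β - n →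
        (n : ℤ) + (b + d) ∈ P 0 ∨ (n : ℤ) - d + (b + d) ∈ P 0 := fun x hx β hβ e => by
      rcases hB' β hβ with rfl | rfl
      · right; convert hx using 1; omega
      · left; convert hx using 1; omega
    have hBC : ∀ β ∈ P 1, ∀ y ∈ P 2, β - n = y →
        b - (n : ℤ) ∈ P 2 ∨ b - (n - d : ℤ) ∈ P 2 := fun β hβ y hy e => by
      rcases hB' β hβ with rfl | rfl
      · left; convert hy using 1
      · right; convert hy using 1; omega
    have hAC : ∀ x ∈ P 0, ∀ y ∈ P 2, x - n * 2 = y →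
        ∃ u ∈ {x | x + (b + d) ∈ P 0}, ∃ w ∈ {y | b - y ∈ P 2}, u + w + d = 2 * (n : ℤ) :=
      fun x hx y hy e => ⟨x - (b + d), by simpa using hx, b - y, by simpa using hy, by omega⟩
    simp only [Set.mem_ofPred_eq] at hAC ⊢
    fin_cases i <;> fin_cases j <;> simp [position] at e hx hy hxy
    · omega
    · have := hAB x hx y hy (by omega); tauto
    · have := hAC x hx y hy (by omega); tauto
    · have := hAB y hy x hx (by omega); tauto
    · omega
    · have := hBC x hx y hy (by omega); tauto
    · have := hAC y hy x hx (by omega); tauto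
    · have := hBC y hy x hx (by omega); tauto
    · omega
  · intro x x' hx hx' e
    have := ab_ab _ hx _ hbd _ hx' _ hb (by omega); omega
  · intro x x' hx hx' e
    have := bc_bc _ hb _ hx _ hbd _ hx' (by omega); omega
  · intro x y hx hy
    have := ab_bc _ hx _ hbd _ hb _ hy; have := ab_bc _ hx _ hb _ hb _ hy
    have := ab_bc _ hx _ hbd _ hbd _ hy; omega
  · intro x y x' hx hy hx'
    have := ab_ac _ hx' _ hbd _ hx _ hy; have := ab_ac _ hx' _ hb _ hx _ hy; omega
  · intro x y x' hx hy hx'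
    have := bc_ac _ hbd _ hx' _ hx _ hy; have := bc_ac _ hb _ hx' _ hx _ hy; omega
  · intro x y x' y' hx hy hx' hy' e
    have := ac_ac _ hx _ hy _ hx' _ hy' (by omega); omega

/-- The partition with middle block `{d, 0}` in which the first block is at distances `X` from `d` and
the third block at distances `Y` from `0`. -/
def ofGaps (X Y : Finset ℤ) (d : ℤ) : Blocks 2 :=
  ![X.image fun x => x + d, {d, 0}, Y.image fun y => -y]

/-- For an Ulrich partition it suffices that the positions are covered. -/
theorem isUlrich_ofGaps {X Y : Finset ℤ} {d : ℤ} (hd : 1 ≤ d) (hX : X.Nonempty) (hY : Y.Nonempty)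
    (hX1 : ∀ x ∈ X, 1 ≤ x) (hY1 : ∀ y ∈ Y, 1 ≤ y)
    (hcov : ∀ n ∈ Finset.Icc (1 : ℤ) (X.card * 2 + X.card * Y.card + 2 * Y.card),
      n ∈ X ∨ n - d ∈ X ∨ n ∈ Y ∨ n - d ∈ Y ∨ ∃ x ∈ X, ∃ y ∈ Y, x + y + d = 2 * n) :
    IsUlrich (ofGaps X Y d) ∧ HasType (ofGaps X Y d) ![X.card, 2, Y.card] := by
  have hd0 : d ≠ 0 := by omega
  have c0 : (ofGaps X Y d 0).card = X.card :=
    Finset.card_image_of_injective _ fun a b h => by simpa using h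
  have c1 : (ofGaps X Y d 1).card = 2 := Finset.card_pair hd0
  have c2 : (ofGaps X Y d 2).card = Y.card :=
    Finset.card_image_of_injective _ fun a b h => by simpa using h
  have m0 : ∀ x, x ∈ X → x + d ∈ ofGaps X Y d 0 := fun x hx => Finset.mem_image.2 ⟨x, hx, rfl⟩
  have m1 : d ∈ ofGaps X Y d 1 := by simp [ofGaps]
  have m1' : 0 ∈ ofGaps X Y d 1 := by simp [ofGaps]
  have m2 : ∀ y, y ∈ Y → -y ∈ ofGaps X Y d 2 := fun y hy => Finset.mem_image.2 ⟨y, hy, rfl⟩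
  refine ⟨⟨⟨?_, ?_⟩, ?_⟩, ?_⟩
  · intro i
    fin_cases i
    · exact hX.image _
    · exact ⟨_, m1⟩
    · exact hY.image _
  · intro i j hij x hx y hy
    have n0 : ∀ x ∈ ofGaps X Y d 0, d < x := fun x hx => by
      obtain ⟨a, ha, rfl⟩ := Finset.mem_image.1 hx
      have := hX1 a ha; omega
    have n1 : ∀ x ∈ ofGaps X Y d 1, x = d ∨ x = 0 := fun x hx => by simpa [ofGaps] using hx
    have n2 : ∀ x ∈ ofGaps X Y d 2, x < 0 := fun x hx => by
      obtain ⟨a, ha, rfl⟩ := Finset.mem_image.1 hx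
      have := hY1 a ha; omega
    fin_cases i <;> fin_cases j <;> simp only [] at hij
    all_goals first | exact absurd hij (by decide) | skip
    · have := n0 x hx; have := n1 y hy; omega
    · have := n0 x hx; have := n2 y hy; omega
    · have := n1 x hx; have := n2 y hy; omega
  · intro t h1 h2
    rw [dim_two, c0, c1, c2] at h2
    have h2' : (t : ℤ) ≤ X.card * 2 + X.card * Y.card + 2 * Y.card := by exact_mod_cast h2
    rcases hcov t (Finset.mem_Icc.2 ⟨by omega, h2'⟩) with h | h | h | h | ⟨x, hx, y, hy, e⟩
    · exact ⟨0, 1, _, m0 _ h, _, m1, by simp, by simp [position]; ring⟩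
    · exact ⟨0, 1, _, m0 _ h, _, m1', by simp, by simp [position]; ring⟩
    · exact ⟨1, 2, _, m1', _, m2 _ h, by simp, by simp [position]⟩
    · exact ⟨1, 2, _, m1, _, m2 _ h, by simp, by simp [position]⟩
    · exact ⟨0, 2, _, m0 _ hx, _, m2 _ hy, by simp, by simp [position]; omega⟩
  · intro i
    fin_cases i
    · exact c0
    · exact c1
    · exact c2

theorem equivalent_of_gaps {P Q : Blocks 2} {b b' d : ℤ} (hP : P 1 = {b, b + d})
    (hQ : Q 1 = {b', b' + d}) (h0 : {x | x + (b + d) ∈ P 0} = {x | x + (b' + d) ∈ Q 0})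
    (h2 : {y | b - y ∈ P 2} = {y | b' - y ∈ Q 2}) : Equivalent P Q := by
  refine ⟨b' - b, fun i => Finset.ext fun a => ?_⟩
  have e : a ∈ (P i).image (fun x => x + (b' - b)) ↔ a - (b' - b) ∈ P i := by
    rw [Finset.mem_image]
    constructor
    · rintro ⟨x, hx, rfl⟩; simpa using hx
    · intro h; exact ⟨_, h, by ring⟩
  rw [e]
  fin_cases i
  · have := Set.ext_iff.1 h0 (a - (b' + d))
    simp only [Set.mem_ofPred_eq, sub_add_cancel] at this
    rw [show a - (b' + d) + (b + d) = a - (b' - b) by ring] at this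
    exact this.symm
  · simp [hP, hQ]; omega
  · have := Set.ext_iff.1 h2 (b' - a)
    simp only [Set.mem_ofPred_eq] at this
    rw [show b - (b' - a) = a - (b' - b) by ring, show b' - (b' - a) = a by ring] at this
    exact this.symm

theorem mem_symmetricDual {P : Blocks 2} {i : Fin 3} {a : ℤ} :
    a ∈ symmetricDual P i ↔ -(a + (dim P + 1) * (i.val : ℤ)) ∈ P i := by
  have hs : dim (symmetric P) = dim P := by
    have c : ∀ i, (symmetric P i).card = (P i.rev).card := fun i =>
      Finset.card_image_of_injective _ neg_injective
    rw [dim_two, dim_two, c, c, c]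
    change (P 2).card * (P 1).card + (P 2).card * (P 0).card + (P 1).card * (P 0).card = _
    ring
  have hv : ((2 : ℕ) : ℤ) - (i.rev.val : ℤ) = i.val := by
    rw [Fin.val_rev]; omega
  simp only [symmetricDual, dual, symmetric, Finset.mem_image, Fin.rev_rev]
  rw [hs]
  simp only [position, hv]
  constructor
  · rintro ⟨_, ⟨x, hx, rfl⟩, rfl⟩
    convert hx using 1; push_cast; ring
  · intro h
    exact ⟨_, ⟨_, h, rfl⟩, by push_cast; ring⟩

theorem three_mul_k (m : ℕ) : 3 * k m + 1 = 4 ^ (m + 1) := by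
  induction m with
  | zero => simp [k]
  | succ m ih =>
    have : k (m + 1) = k m + 4 ^ (m + 1) := Finset.sum_range_succ _ _
    rw [this, pow_succ 4 (m + 1), ← ih]; ring

theorem three_mul_card_upperOffsets (m : ℕ) : 3 * (upperOffsets m).card + 1 = 4 ^ m := by
  induction m with
  | zero => simp [upperOffsets]
  | succ m ih =>
    have hpos : 0 < 4 ^ m := by positivity
    have hs : (4 : ℕ) ^ (m + 1) = 4 * 4 ^ m := by ring
    have e : upperOffsets (m + 1) = upperOffsets m ∪ (Finset.Ico (4 ^ m) (2 * 4 ^ m)).image (2 * ·) := by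
      ext u
      simp only [upperOffsets, Finset.mem_union, Finset.mem_filter, Finset.mem_image, Finset.mem_Ico,
        Nat.even_iff (n := u)]
      constructor
      · rintro ⟨h1, h2, h3⟩
        by_cases hu : u < 4 ^ m
        · exact Or.inl ⟨⟨h1.1, hu⟩, h2, h3⟩
        · have := (odd_log_iff (p := m) (by omega) (by omega)).1 h3
          exact Or.inr ⟨u / 2, by omega, by omega⟩
      · rintro (⟨h1, h2, h3⟩ | ⟨u, h1, rfl⟩)
        · exact ⟨by omega, h2, h3⟩
        · exact ⟨by omega, by omega, (odd_log_iff (p := m) (by omega) (by omega)).2 (by omega)⟩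
    have hdisj : Disjoint (upperOffsets m) ((Finset.Ico (4 ^ m) (2 * 4 ^ m)).image (2 * ·)) := by
      rw [Finset.disjoint_left]
      intro u h1 h2
      simp only [upperOffsets, Finset.mem_filter, Finset.mem_image, Finset.mem_Ico] at h1 h2
      obtain ⟨w, hw, rfl⟩ := h2
      omega
    rw [e, Finset.card_union_of_disjoint hdisj,
      Finset.card_image_of_injective _ (fun a b h => by simpa using h), Nat.card_Ico]
    omega

theorem clog_eq_of {j w : ℕ} (h1 : 2 ^ j < w) (h2 : w ≤ 2 ^ (j + 1)) : Nat.clog 2 w = j + 1 := by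
  apply le_antisymm
  · exact (Nat.clog_le_iff_le_pow (by norm_num)).2 h2
  · exact (Nat.lt_clog_iff_pow_lt (by norm_num)).2 h1

theorem three_mul_card_lowerOffsets (n : ℕ) : 3 * (lowerOffsets n).card + 1 = 4 ^ n := by
  induction n with
  | zero => decide
  | succ m ih =>
    have hpos : 0 < 4 ^ m := by positivity
    have hs : (4 : ℕ) ^ (m + 1) = 4 * 4 ^ m := by ring
    have e4 : (4 : ℕ) ^ m = 2 ^ (2 * m) := by rw [pow_mul]; norm_num
    have e : lowerOffsets (m + 1) = lowerOffsets m ∪ (Finset.Ioc (4 ^ m) (2 * 4 ^ m)).image (2 * ·) := by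
      ext u
      simp only [lowerOffsets, Finset.mem_union, Finset.mem_filter, Finset.mem_image, Finset.mem_Icc,
        Finset.mem_Ioc, Nat.even_iff (n := u)]
      constructor
      · rintro ⟨h1, h2, h3⟩
        by_cases hu : u ≤ 4 ^ m
        · exact Or.inl ⟨⟨h1.1, hu⟩, h2, h3⟩
        by_cases hu' : u ≤ 2 * 4 ^ m
        · rw [clog_eq_of (j := 2 * m) (by omega) (by rw [pow_succ]; omega)] at h3
          exact absurd h3 (Nat.not_even_iff_odd.2 ⟨m, rfl⟩)
        · exact Or.inr ⟨u / 2, by omega, by omega⟩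
      · rintro (⟨h1, h2, h3⟩ | ⟨u, h1, rfl⟩)
        · exact ⟨by omega, h2, h3⟩
        · refine ⟨by omega, by omega, ?_⟩
          rw [clog_eq_of (j := 2 * m + 1) (by rw [pow_succ]; omega)
            (by rw [pow_succ, pow_succ]; omega)]
          exact ⟨m + 1, by ring⟩
    have hdisj : Disjoint (lowerOffsets m) ((Finset.Ioc (4 ^ m) (2 * 4 ^ m)).image (2 * ·)) := by
      rw [Finset.disjoint_left]
      intro u h1 h2
      simp only [lowerOffsets, Finset.mem_filter, Finset.mem_image, Finset.mem_Ioc, Finset.mem_Icc] at h1 h2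
      obtain ⟨w, hw, rfl⟩ := h2
      omega
    rw [e, Finset.card_union_of_disjoint hdisj,
      Finset.card_image_of_injective _ (fun a b h => by simpa using h), Nat.card_Ioc]
    omega

theorem three_mul_card_pattern (n m : ℕ) : 3 * (pattern n m).card + 2 = 4 ^ n + 4 ^ m := by
  have hdisj : Disjoint ((upperOffsets m).image (fun u : ℕ => (4 ^ n + 1 + u : ℤ)))
      ((lowerOffsets n).image (fun u : ℕ => (4 ^ n + 1 - u : ℤ))) := by
    rw [Finset.disjoint_left]
    intro x h1 h2
    simp only [upperOffsets, lowerOffsets, Finset.mem_filter, Finset.mem_image, Finset.mem_Ico,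
      Finset.mem_Icc] at h1 h2
    obtain ⟨u, hu, rfl⟩ := h1
    obtain ⟨w, hw, e⟩ := h2
    omega
  rw [pattern, Finset.card_union_of_disjoint hdisj,
    Finset.card_image_of_injective _ (fun a b h => by simpa using h),
    Finset.card_image_of_injective _ (fun a b h => by simpa using h)]
  have := three_mul_card_upperOffsets m
  have := three_mul_card_lowerOffsets n
  omega

theorem isUlrich_pattern (n m : ℕ) (h : 0 < (pattern n m).card) :
    IsUlrich (ofGaps {(4 : ℤ) ^ n} (pattern n m) 1) ∧
      HasType (ofGaps {(4 : ℤ) ^ n} (pattern n m) 1) ![1, 2, (pattern n m).card] := by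
  have hn : (4 : ℤ) ^ n = (4 ^ n : ℕ) := by push_cast; rfl
  have hpos : 0 < 4 ^ n := by positivity
  refine isUlrich_ofGaps le_rfl (by simp) (Finset.card_pos.1 h) ?_ ?_ ?_
  · intro x hx
    rw [Finset.mem_singleton] at hx; omega
  · intro y hy
    rcases mem_pattern.1 hy with ⟨u, rfl, hu⟩ | ⟨u, rfl, hu⟩ <;> omega
  · intro t ht
    rw [Finset.card_singleton] at ht
    have hc := three_mul_card_pattern n m
    have ht' : 1 ≤ t ∧ t ≤ (4 ^ n + 4 ^ m : ℕ) := by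
      rw [Finset.mem_Icc] at ht; omega
    simp only [Finset.mem_singleton, exists_eq_left]
    rcases lt_trichotomy t (4 ^ n) with hlt | rfl | hlt
    · -- `t = 4 ^ n + 1 - w` with `2 ≤ w`
      obtain ⟨w, hw⟩ : ∃ w : ℕ, t = 4 ^ n + 1 - w := ⟨(4 ^ n + 1 - t).toNat, by omega⟩
      by_cases hev : Even (Nat.clog 2 w)
      · rcases Nat.even_or_odd' w with ⟨u, hu | hu⟩
        · exact Or.inr (Or.inr (Or.inl (mem_pattern.2 (Or.inr ⟨w, hw, by omega, by omega, by omega, hev⟩))))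
        · refine Or.inr (Or.inr (Or.inr (Or.inl (mem_pattern.2 (Or.inr ⟨w + 1, by omega, by omega, ?_, by omega, ?_⟩)))))
          · by_contra hgt
            have hn0 : n = 0 ∨ 4 ^ n % 2 = 0 := by
              rcases n with _ | n
              · exact Or.inl rfl
              · right; rw [pow_succ]; omega
            rcases hn0 with rfl | h0
            · simp at hlt; omega
            · omega
          · rw [show w + 1 = 2 * (u + 1) by omega, clog_two_mul (by omega)]
            rwa [show w = 2 * (u + 1) - 1 by omega, clog_two_mul_sub_one (by omega)] at hev
      · refine Or.inr (Or.inr (Or.inr (Or.inr ⟨4 ^ n + 1 - (2 * w : ℕ), mem_pattern.2 (Or.inr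
          ⟨2 * w, rfl, by omega, ?_, by omega, ?_⟩), by push_cast; omega⟩)))
        · by_contra hgt
          apply hev
          rcases n with _ | n
          · simp at hlt; omega
          have e4 : (4 : ℕ) ^ (n + 1) = 4 * 2 ^ (2 * n) := by rw [pow_mul, pow_succ]; norm_num; ring
          rw [clog_eq_of (j := 2 * n + 1) (by rw [pow_succ]; omega)
            (by rw [pow_succ, pow_succ]; omega)]
          exact ⟨n + 1, by ring⟩
        · rw [clog_two_mul (by omega)]
          exact Nat.even_add_one.2 hev
    · exact Or.inl rfl
    · rcases eq_or_lt_of_le (show (4 : ℤ) ^ n + 1 ≤ t by omega) with rfl | hlt'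
      · exact Or.inr (Or.inl (by ring))
      obtain ⟨w, hw⟩ : ∃ w : ℕ, t = 4 ^ n + 1 + w := ⟨(t - (4 ^ n + 1)).toNat, by omega⟩
      by_cases hodd : Odd (Nat.log 2 w)
      · rcases Nat.even_or_odd' w with ⟨u, hu | hu⟩
        · exact Or.inr (Or.inr (Or.inl (mem_pattern.2 (Or.inl ⟨w, hw, by omega, by omega, by omega, hodd⟩))))
        · have hu1 : 1 ≤ u := by
            by_contra hlt
            obtain rfl : w = 1 := by omega
            simp at hodd
          refine Or.inr (Or.inr (Or.inr (Or.inl (mem_pattern.2 (Or.inl ⟨2 * u, by omega, by omega, by omega, by omega, ?_⟩)))))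
          rw [log_two_mul hu1]
          rwa [hu, log_two_mul_add_one hu1] at hodd
      · refine Or.inr (Or.inr (Or.inr (Or.inr ⟨4 ^ n + 1 + (2 * w : ℕ), mem_pattern.2 (Or.inl
          ⟨2 * w, rfl, by omega, ?_, by omega, ?_⟩), by push_cast; omega⟩)))
        · by_contra hge
          apply hodd
          rcases m with _ | m
          · omega
          have e4 : (4 : ℕ) ^ (m + 1) = 4 * 4 ^ m := by ring
          exact (odd_log_iff (p := m) (by omega) (by omega)).2 (by omega)
        · rw [log_two_mul (by omega)]
          exact Nat.odd_add_one.2 hodd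

end UlrichPartition

/-! ### The classification -/

namespace UlrichPartition

/-- The tilings of `[1, N]`, up to exchanging `X` and `Y`. -/
def IsStandard (X Y : Set ℤ) (d N : ℤ) : Prop :=
  (d = 5 ∧ N = 8 ∧ X = {1, 3} ∧ Y = {2}) ∨ (d = 3 ∧ N = 5 ∧ X = {1} ∧ Y = {2}) ∨
  (d = 3 ∧ N = 12 ∧ X = {1, 9} ∧ Y = {2, 8}) ∨ (d = 3 ∧ N = 16 ∧ X = {1, 7, 13} ∧ Y = {2, 12}) ∨
  (d = 1 ∧ ∃ n m : ℕ, N = 4 ^ n + 4 ^ m ∧ X = {(4 : ℤ) ^ n} ∧ Y = pattern n m)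

theorem Tiling.isStandard_of_one_mem {X Y : Set ℤ} {d N : ℤ} (T : Tiling X Y d 1 N) (h1 : 1 ∈ X) :
    IsStandard X Y d N ∨ IsStandard Y X d N := by
  unfold IsStandard
  rcases T.gap_eq_one_or_three_or_five h1 with rfl | rfl | rfl
  · obtain ⟨n, m, hN, ⟨hY, hX⟩ | ⟨hX, hY⟩⟩ := T.eq_of_gap_one h1
    · exact Or.inr (Or.inr (Or.inr (Or.inr (Or.inr ⟨rfl, n, m, hN, hY, hX⟩))))
    · exact Or.inl (Or.inr (Or.inr (Or.inr (Or.inr ⟨rfl, n, m, hN, hX, hY⟩))))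
  · rcases T.eq_of_gap_three h1 with h | h | h
    · exact Or.inl (Or.inr (Or.inl ⟨rfl, h⟩))
    · exact Or.inl (Or.inr (Or.inr (Or.inl ⟨rfl, h⟩)))
    · exact Or.inl (Or.inr (Or.inr (Or.inr (Or.inl ⟨rfl, h⟩))))
  · exact Or.inl (Or.inl ⟨rfl, T.eq_of_gap_five h1⟩)

theorem Tiling.isStandard {X Y : Set ℤ} {d N : ℤ} (T : Tiling X Y d 1 N) :
    IsStandard X Y d N ∨ IsStandard Y X d N := by
  rcases T.first_mem with h | h
  · exact T.isStandard_of_one_mem h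
  · exact (T.swap.isStandard_of_one_mem h).symm

/-- The tiling of an Ulrich partition of type `(α, 2, γ)`. -/
theorem exists_tiling {P : Blocks 2} {α γ : ℕ} (hP : IsUlrich P) (hT : HasType P ![α, 2, γ]) :
    ∃ b d : ℤ, P 1 = {b, b + d} ∧ (dim P : ℤ) = 2 * α + 2 * γ + α * γ ∧
      Tiling {x | x + (b + d) ∈ P 0} {y | b - y ∈ P 2} d 1 (dim P) ∧
      {x | x + (b + d) ∈ P 0}.ncard = α ∧ {y | b - y ∈ P 2}.ncard = γ := by
  have t0 : (P 0).card = α := hT 0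
  have t1 : (P 1).card = 2 := hT 1
  have t2 : (P 2).card = γ := hT 2
  obtain ⟨b, d, hd, hB⟩ : ∃ b d : ℤ, 1 ≤ d ∧ P 1 = {b, b + d} := by
    obtain ⟨u, w, huw, h⟩ := Finset.card_eq_two.1 t1
    rcases lt_or_gt_of_ne huw with hlt | hlt
    · exact ⟨u, w - u, by omega, by rw [h]; simp⟩
    · exact ⟨w, u - w, by omega, by rw [h, Finset.pair_comm]; simp⟩
  refine ⟨b, d, hB, ?_, tiling_of_isUlrich hP hd hB, ?_, ?_⟩
  · rw [dim_two, t0, t1, t2]; push_cast; ring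
  · have : {x | x + (b + d) ∈ P 0} = ((P 0).image fun x => x - (b + d) : Finset ℤ) := by
      ext x
      simp only [Set.mem_ofPred_eq, Finset.coe_image, Set.mem_image, Finset.mem_coe]
      exact ⟨fun h => ⟨_, h, by ring⟩, by rintro ⟨y, hy, rfl⟩; simpa using hy⟩
    rw [this, Set.ncard_coe_finset, Finset.card_image_of_injective _ (fun a b h => by simpa using h),
      t0]
  · have : {y | b - y ∈ P 2} = ((P 2).image fun x => b - x : Finset ℤ) := by
      ext x
      simp only [Set.mem_ofPred_eq, Finset.coe_image, Set.mem_image, Finset.mem_coe]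
      exact ⟨fun h => ⟨_, h, by ring⟩, by rintro ⟨y, hy, rfl⟩; simpa using hy⟩
    rw [this, Set.ncard_coe_finset, Finset.card_image_of_injective _ (fun a b h => by simpa using h),
      t2]

theorem isListed_one_of_sum {n m γ : ℕ} (h : 4 ^ n + 4 ^ m = 3 * γ + 2) (hγ : 1 ≤ γ) :
    IsListed 1 γ := by
  rcases n with _ | n <;> rcases m with _ | m
  · simp at h; omega
  · have := three_mul_k m
    exact Or.inr (Or.inr (Or.inl ⟨rfl, m, by rw [pow_zero] at h; omega⟩))
  · have := three_mul_k n
    exact Or.inr (Or.inr (Or.inl ⟨rfl, n, by rw [pow_zero] at h; omega⟩))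
  · have := three_mul_k m
    have := three_mul_k n
    exact Or.inr (Or.inr (Or.inr ⟨rfl, n, m, by omega⟩))

theorem ncard_triple {a b c : ℤ} (h1 : a ≠ b) (h2 : a ≠ c) (h3 : b ≠ c) :
    ({a, b, c} : Set ℤ).ncard = 3 := by
  rw [Set.ncard_eq_toFinset_card']
  simp [h1, h2, h3]

theorem IsStandard.isListed {X Y : Set ℤ} {d N : ℤ} {α γ : ℕ} (h : IsStandard X Y d N)
    (hN : N = 2 * α + 2 * γ + α * γ) (hX : X.ncard = α) (hY : Y.ncard = γ) (hγ : 1 ≤ γ) :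
    IsListed α γ ∨ IsListed γ α := by
  rcases h with ⟨-, -, rfl, rfl⟩ | ⟨-, -, rfl, rfl⟩ | ⟨-, -, rfl, rfl⟩ | ⟨-, -, rfl, rfl⟩ |
    ⟨-, n, m, hN', rfl, -⟩
  · rw [Set.ncard_pair (by norm_num)] at hX
    rw [Set.ncard_singleton] at hY
    subst hX hY
    exact Or.inr (isListed_one_of_sum (n := 1) (m := 1) (by norm_num) (by norm_num))
  · rw [Set.ncard_singleton] at hX hY
    subst hX hY
    exact Or.inl (isListed_one_of_sum (n := 1) (m := 0) (by norm_num) (by norm_num))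
  · rw [Set.ncard_pair (by norm_num)] at hX hY
    exact Or.inl (Or.inl ⟨hX.symm, hY.symm⟩)
  · rw [ncard_triple (by norm_num) (by norm_num) (by norm_num)] at hX
    rw [Set.ncard_pair (by norm_num)] at hY
    exact Or.inr (Or.inr (Or.inl ⟨hY.symm, hX.symm⟩))
  · rw [Set.ncard_singleton] at hX
    subst hX
    refine Or.inl (isListed_one_of_sum (n := n) (m := m) ?_ hγ)
    have : ((4 ^ n + 4 ^ m : ℕ) : ℤ) = (3 * γ + 2 : ℕ) := by push_cast; rw [← hN', hN]; push_cast; ring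
    exact_mod_cast this

theorem four_pow_add_inj {n m n' m' : ℕ} (h : 4 ^ n + 4 ^ m = 4 ^ n' + 4 ^ m') :
    (n = n' ∧ m = m') ∨ (n = m' ∧ m = n') := by
  have key : ∀ a b a' b' : ℕ, a ≤ b → a' ≤ b' → 4 ^ a + 4 ^ b = 4 ^ a' + 4 ^ b' → b ≤ b' := by
    intro a b a' b' hab hab' e
    by_contra hlt
    have h1 : 4 ^ a' ≤ 4 ^ b' := Nat.pow_le_pow_right (by norm_num) hab'
    have h2 : 4 ^ (b' + 1) ≤ 4 ^ b := Nat.pow_le_pow_right (by norm_num) (by omega)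
    have h3 : 0 < 4 ^ b' := by positivity
    have h4 : 0 < 4 ^ a := by positivity
    rw [pow_succ] at h2
    omega
  have key2 : ∀ a b a' b' : ℕ, a ≤ b → a' ≤ b' → 4 ^ a + 4 ^ b = 4 ^ a' + 4 ^ b' →
      a = a' ∧ b = b' := by
    intro a b a' b' hab hab' e
    obtain rfl : b = b' := le_antisymm (key _ _ _ _ hab hab' e) (key _ _ _ _ hab' hab e.symm)
    exact ⟨Nat.pow_right_injective (le_refl 2 |>.trans (by norm_num)) (Nat.add_right_cancel e), rfl⟩
  rcases le_total n m with h1 | h1 <;> rcases le_total n' m' with h2 | h2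
  · exact Or.inl (key2 _ _ _ _ h1 h2 h)
  · have := key2 _ _ _ _ h1 h2 (by rw [h, add_comm]); tauto
  · have := key2 _ _ _ _ h1 h2 (by rw [← h, add_comm]); tauto
  · have := key2 _ _ _ _ h1 h2 (by rw [add_comm, h, add_comm]); tauto

theorem IsStandard.eq_of_singleton {X Y : Set ℤ} {d N : ℤ} {γ : ℕ}
    (h : IsStandard X Y d N ∨ IsStandard Y X d N) (hX : X.ncard = 1) (hY : Y.ncard = γ)
    (hγ : 3 ≤ γ) :
    d = 1 ∧ ∃ n m : ℕ, N = 4 ^ n + 4 ^ m ∧ X = {(4 : ℤ) ^ n} ∧ Y = pattern n m := by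
  rcases h with h | h
  · rcases h with ⟨-, -, rfl, rfl⟩ | ⟨-, -, rfl, rfl⟩ | ⟨-, -, rfl, rfl⟩ | ⟨-, -, rfl, rfl⟩ | h
    · rw [Set.ncard_singleton] at hY; omega
    · rw [Set.ncard_singleton] at hY; omega
    · rw [Set.ncard_pair (by norm_num)] at hY; omega
    · rw [Set.ncard_pair (by norm_num)] at hY; omega
    · exact h
  · exfalso
    rcases h with ⟨-, -, rfl, rfl⟩ | ⟨-, -, rfl, rfl⟩ | ⟨-, -, rfl, rfl⟩ | ⟨-, -, rfl, rfl⟩ |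
      ⟨-, n, m, -, rfl, -⟩
    · rw [Set.ncard_pair (by norm_num)] at hY; omega
    · rw [Set.ncard_singleton] at hY; omega
    · rw [Set.ncard_pair (by norm_num)] at hY; omega
    · rw [Set.ncard_pair (by norm_num)] at hX; omega
    · rw [Set.ncard_singleton] at hY; omega

theorem IsStandard.eq_of_two_three {X Y : Set ℤ} {d N : ℤ}
    (h : IsStandard X Y d N ∨ IsStandard Y X d N) (hX : X.ncard = 2) (hY : Y.ncard = 3) :
    d = 3 ∧ X = {2, 12} ∧ Y = {1, 7, 13} := by
  rcases h with h | h
  · exfalso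
    rcases h with ⟨-, -, rfl, rfl⟩ | ⟨-, -, rfl, rfl⟩ | ⟨-, -, rfl, rfl⟩ | ⟨-, -, rfl, rfl⟩ |
      ⟨-, n, m, -, rfl, -⟩
    · rw [Set.ncard_singleton] at hY; omega
    · rw [Set.ncard_singleton] at hY; omega
    · rw [Set.ncard_pair (by norm_num)] at hY; omega
    · rw [Set.ncard_pair (by norm_num)] at hY; omega
    · rw [Set.ncard_singleton] at hX; omega
  · rcases h with ⟨-, -, rfl, rfl⟩ | ⟨-, -, rfl, rfl⟩ | ⟨-, -, rfl, rfl⟩ | ⟨h, -, rfl, rfl⟩ |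
      ⟨-, n, m, -, rfl, -⟩
    · rw [Set.ncard_pair (by norm_num)] at hY; omega
    · rw [Set.ncard_singleton] at hY; omega
    · rw [Set.ncard_pair (by norm_num)] at hY; omega
    · exact ⟨h, rfl, rfl⟩
    · rw [Set.ncard_singleton] at hY; omega

/-- The symmetric dual of the partition with parameters `(n, m)` is that with parameters `(m, n)`. -/
theorem equivalent_of_one_two {γ : ℕ} (hγ : 3 ≤ γ) {P Q : Blocks 2} (hP : IsUlrich P)
    (hPT : HasType P ![1, 2, γ]) (hQ : IsUlrich Q) (hQT : HasType Q ![1, 2, γ]) :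
    Equivalent P Q ∨ Equivalent (symmetricDual P) Q := by
  obtain ⟨b, d, hB, hN, T, hX, hY⟩ := exists_tiling hP hPT
  obtain ⟨b', d', hB', hN', T', hX', hY'⟩ := exists_tiling hQ hQT
  obtain ⟨rfl, n, m, e, eX, eY⟩ := IsStandard.eq_of_singleton T.isStandard hX hY hγ
  obtain ⟨rfl, n', m', e', eX', eY'⟩ := IsStandard.eq_of_singleton T'.isStandard hX' hY' hγ
  have hsum : 4 ^ n + 4 ^ m = 4 ^ n' + 4 ^ m' := by
    have : ((4 ^ n + 4 ^ m : ℕ) : ℤ) = (4 ^ n' + 4 ^ m' : ℕ) := by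
      push_cast; rw [← e, ← e', hN, hN']
    exact_mod_cast this
  rcases four_pow_add_inj hsum with ⟨rfl, rfl⟩ | ⟨rfl, rfl⟩
  · exact Or.inl (equivalent_of_gaps hB hB' (eX.trans eX'.symm) (eY.trans eY'.symm))
  · right
    have hcard : ∀ A : Set ℤ, {u : ℤ | 1 + (dim P : ℤ) - 1 - u ∈ A}.ncard = A.ncard := fun A => by
      have : A = (fun u => 1 + (dim P : ℤ) - 1 - u) '' {u : ℤ | 1 + (dim P : ℤ) - 1 - u ∈ A} := by
        ext u
        constructor
        · intro hu
          refine ⟨1 + (dim P : ℤ) - 1 - u, ?_, by ring⟩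
          change 1 + (dim P : ℤ) - 1 - (1 + (dim P : ℤ) - 1 - u) ∈ A
          convert hu using 1; ring
        · rintro ⟨w, hw, rfl⟩; exact hw
      conv_rhs => rw [this]
      rw [Set.ncard_image_of_injective _ (fun a b h => by simpa using h)]
    obtain ⟨-, i, j, f, fX, fY⟩ := IsStandard.eq_of_singleton T.reflect.isStandard
      ((hcard _).trans hX) ((hcard _).trans hY) hγ
    have hm : (4 : ℤ) ^ m = 4 ^ i := by
      have : (4 : ℤ) ^ m ∈ {u : ℤ | 1 + (dim P : ℤ) - 1 - u ∈ {x | x + (b + 1) ∈ P 0}} := by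
        change 1 + (dim P : ℤ) - 1 - 4 ^ m ∈ {x | x + (b + 1) ∈ P 0}
        rw [eX, Set.mem_singleton_iff]; omega
      rw [fX] at this
      exact this
    obtain rfl : m = i := Nat.pow_right_injective (le_refl 2 |>.trans (by norm_num))
      (show 4 ^ m = 4 ^ i by exact_mod_cast hm)
    obtain rfl : n = j := Nat.pow_right_injective (le_refl 2 |>.trans (by norm_num))
      (show 4 ^ n = 4 ^ j by
        have : (4 : ℤ) ^ n = 4 ^ j := by omega
        exact_mod_cast this)
    refine equivalent_of_gaps (b := -b - 1 - (dim P + 1)) (d := 1) ?_ hB' ?_ ?_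
    · ext a
      rw [mem_symmetricDual, hB]
      simp; omega
    · rw [eX', ← fX]
      ext a
      simp only [Set.mem_ofPred_eq, mem_symmetricDual]
      congr! 1; simp; ring
    · rw [eY', ← fY]
      ext a
      simp only [Set.mem_ofPred_eq, mem_symmetricDual]
      congr! 1; simp; ring

theorem equivalent_of_two_three {P Q : Blocks 2} (hP : IsUlrich P)
    (hPT : HasType P ![2, 2, 3]) (hQ : IsUlrich Q) (hQT : HasType Q ![2, 2, 3]) :
    Equivalent P Q := by
  obtain ⟨b, d, hB, hN, T, hX, hY⟩ := exists_tiling hP hPT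
  obtain ⟨b', d', hB', hN', T', hX', hY'⟩ := exists_tiling hQ hQT
  obtain ⟨rfl, eX, eY⟩ := IsStandard.eq_of_two_three T.isStandard hX hY
  obtain ⟨rfl, eX', eY'⟩ := IsStandard.eq_of_two_three T'.isStandard hX' hY'
  exact equivalent_of_gaps hB hB' (eX.trans eX'.symm) (eY.trans eY'.symm)

theorem exists_ulrich_of_sum {n m γ : ℕ} (h : 4 ^ n + 4 ^ m = 3 * γ + 2) (hγ : 1 ≤ γ) :
    ∃ P : Blocks 2, IsUlrich P ∧ HasType P ![1, 2, γ] := by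
  have hc := three_mul_card_pattern n m
  obtain rfl : γ = (pattern n m).card := by omega
  exact ⟨_, isUlrich_pattern n m hγ⟩

/-- The difference `d` of the middle block is invariant under equivalence and symmetric duality. -/
theorem gap_eq_of_equivalent {X Y X' Y' : Finset ℤ} {d d' : ℤ} (hd : 1 ≤ d) (hd' : 1 ≤ d')
    (h : Equivalent (ofGaps X Y d) (ofGaps X' Y' d') ∨
      Equivalent (symmetricDual (ofGaps X Y d)) (ofGaps X' Y' d')) : d = d' := by
  have key : ∀ {R : Blocks 2} {b : ℤ}, R 1 = {b, b + d} → Equivalent R (ofGaps X' Y' d') → d = d' := by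
    rintro R b hR ⟨c, hc⟩
    have h1 : ({d', 0} : Finset ℤ) = ({b, b + d} : Finset ℤ).image (fun x => x + c) := by
      rw [← hR]; exact hc 1
    have m1 : d' ∈ ({b, b + d} : Finset ℤ).image (fun x => x + c) := by rw [← h1]; simp
    have m0 : 0 ∈ ({b, b + d} : Finset ℤ).image (fun x => x + c) := by rw [← h1]; simp
    simp at m0 m1
    omega
  rcases h with h | h
  · exact key (b := 0) (by simp [ofGaps, Finset.pair_comm]) h
  · refine key (b := -d - (dim (ofGaps X Y d) + 1)) ?_ h
    ext a
    rw [mem_symmetricDual]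
    simp [ofGaps]; omega

end UlrichPartition

open UlrichPartition in
/-- Classification of the Ulrich partitions of type `(α, 2, γ)`: existence for all the listed types;
completeness of the list up to reversing the type (that is, up to replacing `P` by its symmetric
partition); and, among the listed types, uniqueness modulo equivalence and symmetric dual exactly
outside the types `(1, 2, 1)`, `(1, 2, 2)` and `(2, 2, 2)`. -/
theorem theorem5p3 :
    ((∃ P : Blocks 2, IsUlrich P ∧ HasType P ![2, 2, 2]) ∧
      (∃ P : Blocks 2, IsUlrich P ∧ HasType P ![2, 2, 3]) ∧
      (∀ m₁ : ℕ, ∃ P : Blocks 2, IsUlrich P ∧ HasType P ![1, 2, k m₁]) ∧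
      (∀ m₁ m₂ : ℕ, ∃ P : Blocks 2, IsUlrich P ∧ HasType P ![1, 2, k m₁ + k m₂])) ∧
    (∀ (α γ : ℕ) (P : Blocks 2), IsUlrich P → HasType P ![α, 2, γ] →
      IsListed α γ ∨ IsListed γ α) ∧
    (∀ α γ : ℕ, IsListed α γ →
      ((∀ P Q : Blocks 2, IsUlrich P → HasType P ![α, 2, γ] →
          IsUlrich Q → HasType Q ![α, 2, γ] →
          Equivalent P Q ∨ Equivalent (symmetricDual P) Q) ↔
        ¬ ((α = 1 ∧ γ = 1) ∨ (α = 1 ∧ γ = 2) ∨ (α = 2 ∧ γ = 2)))) := by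
  have kpos : ∀ m, 1 ≤ k m := fun m => by
    have := three_mul_k m
    have : 4 ^ 1 ≤ 4 ^ (m + 1) := Nat.pow_le_pow_right (by norm_num) (by omega)
    omega
  have u22 := isUlrich_ofGaps (X := {1, 9}) (Y := {2, 8}) (d := 3) (by norm_num) (by simp) (by simp)
    (by decide) (by decide) (by decide)
  have u22' := isUlrich_ofGaps (X := {2, 8}) (Y := {1, 9}) (d := 3) (by norm_num) (by simp) (by simp)
    (by decide) (by decide) (by decide)
  have u23 := isUlrich_ofGaps (X := {2, 12}) (Y := {1, 7, 13}) (d := 3) (by norm_num) (by simp)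
    (by simp) (by decide) (by decide) (by decide)
  have u11 := isUlrich_ofGaps (X := {4}) (Y := {1}) (d := 1) (by norm_num) (by simp) (by simp)
    (by decide) (by decide) (by decide)
  have u11' := isUlrich_ofGaps (X := {1}) (Y := {2}) (d := 3) (by norm_num) (by simp) (by simp)
    (by decide) (by decide) (by decide)
  have u12 := isUlrich_ofGaps (X := {4}) (Y := {1, 7}) (d := 1) (by norm_num) (by simp) (by simp)
    (by decide) (by decide) (by decide)
  have u12' := isUlrich_ofGaps (X := {2}) (Y := {1, 3}) (d := 5) (by norm_num) (by simp) (by simp)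
    (by decide) (by decide) (by decide)
  refine ⟨⟨⟨_, u22⟩, ⟨_, u23⟩, fun m => ?_, fun m m' => ?_⟩, ?_, ?_⟩
  · have := three_mul_k m
    exact exists_ulrich_of_sum (n := m + 1) (m := 0) (by rw [← this]; ring) (kpos m)
  · have := three_mul_k m
    have := three_mul_k m'
    have := kpos m
    exact exists_ulrich_of_sum (n := m + 1) (m := m' + 1) (by omega) (by omega)
  · intro α γ P hP hT
    obtain ⟨b, d, hB, hN, T, hX, hY⟩ := exists_tiling hP hT
    have hα : 1 ≤ α := by
      have e : (P 0).card = α := hT 0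
      rw [← e]; exact Finset.card_pos.2 (hP.1.1 0)
    have hγ : 1 ≤ γ := by
      have e : (P 2).card = γ := hT 2
      rw [← e]; exact Finset.card_pos.2 (hP.1.1 2)
    rcases T.isStandard with h | h
    · exact h.isListed hN hX hY hγ
    · exact (h.isListed (by rw [hN]; ring) hY hX hα).symm
  · intro α γ hL
    constructor
    · intro hu hex
      rcases hex with ⟨rfl, rfl⟩ | ⟨rfl, rfl⟩ | ⟨rfl, rfl⟩
      · have := gap_eq_of_equivalent (by norm_num) (by norm_num) (hu _ _ u11.1 u11.2 u11'.1 u11'.2)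
        norm_num at this
      · have := gap_eq_of_equivalent (by norm_num) (by norm_num) (hu _ _ u12.1 u12.2 u12'.1 u12'.2)
        norm_num at this
      · have h5 : (5 : ℤ) ∈ ofGaps {2, 8} {1, 9} 3 0 := by decide
        have h11 : (11 : ℤ) ∈ ofGaps {2, 8} {1, 9} 3 0 := by decide
        rcases hu _ _ u22.1 u22.2 u22'.1 u22'.2 with ⟨c, hc⟩ | ⟨c, hc⟩
        · rw [hc 0, Finset.mem_image] at h5 h11
          obtain ⟨x, hx, ex⟩ := h5
          obtain ⟨y, hy, ey⟩ := h11
          simp [ofGaps] at hx hy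
          omega
        · rw [hc 0, Finset.mem_image] at h5 h11
          obtain ⟨x, hx, ex⟩ := h5
          obtain ⟨y, hy, ey⟩ := h11
          rw [mem_symmetricDual] at hx hy
          simp [ofGaps] at hx hy
          omega
    · intro hne P Q hP hPT hQ hQT
      have hγ : 1 ≤ γ := by
        have e : (P 2).card = γ := hPT 2
        rw [← e]; exact Finset.card_pos.2 (hP.1.1 2)
      rcases hL with ⟨rfl, rfl⟩ | ⟨rfl, rfl⟩ | ⟨rfl, h⟩ | ⟨rfl, h⟩
      · exact absurd (by simp) hne
      · exact Or.inl (equivalent_of_two_three hP hPT hQ hQT)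
      · exact equivalent_of_one_two (by omega) hP hPT hQ hQT
      · exact equivalent_of_one_two (by omega) hP hPT hQ hQT
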